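/- Let $G=\mathrm{SL}_3(\mathbb R)$, $K=\mathrm{SO}(3)$, and let $X=G/K$ be the Riemannian symmetric space with the distance $d$ of the Riemannian metric induced by the Killing form $B(x,y)=6\operatorname{Tr}(xy)$; put $o=[K]\in X$. (Equivalently, $X$ is the space of positive definite symmetric real $3\times 3$ matrices of determinant one, $G$ acts by $g\cdot P=gPg^{T}$, and $o$ is the identity matrix.) Let $H$ be the identity component of $$\mathrm{SO}(F)=\{g\in G: F(gv)=F(v)\ \text{for all } v\in\mathbb R^3\},\qquad F(x,y,z)=2xz-y^2,$$ and let $Y=H\cdot o\subset X$, a totally geodesic plane. Every $x\in X$ has a unique nearest point $\pi(x)$ in $Y$, that is, a unique point $\pi(x)\in Y$ with $d(x,\pi(x))=\inf_{y\in Y}d(x,y)$; let $\pi:X\to Y$ be this nearest-point projection. Let $A<G$ be the group of diagonal matrices with positive entries, let $A_0=H\cap A$, and for $t\in\mathbb R$ let $a_t=\mathrm{diag}(e^{t},e^{-2t},e^{t})$. Every complete geodesic $L\subset Y$ is of the form $L=hA_0o$ with $h\in H$, and the floating geodesic plane over $L$ at height $t\in\mathbb R$ is $Y_{L,t}=h\,a_tY$,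 which does not depend on the choice of such an $h$. Theorem. For every complete geodesic $L\subset Y$, the Hausdorff distance between $\pi(Y_{L,t})$ and $L$ tends to $0$ as $|t|\to\infty$. -/

import Mathlib

open Matrix Filter Topology
open scoped Pointwise ENNReal

noncomputable section

namespace FloatingPlane

/-- The group `G = SL₃(ℝ)`. -/
abbrev G : Type := Matrix.SpecialLinearGroup (Fin 3) ℝ

/-- The symmetric space `X = SL₃(ℝ) / SO(3)`, realised as the space of positive definite symmetric
real `3 × 3` matrices of determinant one; the coset `g SO(3)` corresponds to `g gᵀ`. -/
@[ext]
structure X : Type where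
  mat : Matrix (Fin 3) (Fin 3) ℝ
  posDef : mat.PosDef
  det_eq_one : mat.det = 1

/-- The action of `G` on `X` by left translation of cosets, that is, `g • P = g P gᵀ`. -/
instance : MulAction G X where
  smul g P :=
    { mat := g.1 * P.mat * g.1ᵀ
      posDef := by
        have h := P.posDef.mul_mul_conjTranspose_same (B := g.1)
          (Matrix.vecMul_injective_of_isUnit
            ((Matrix.isUnit_iff_isUnit_det _).2 (by rw [g.2]; exact isUnit_one)))
        simpa [Matrix.conjTranspose_eq_transpose_of_trivial] using h
      det_eq_one := by
        rw [Matrix.det_mul, Matrix.det_mul, Matrix.det_transpose, g.2, P.det_eq_one]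
        norm_num }
  one_smul P := by
    apply X.ext
    change (1 : G).1 * P.mat * (1 : G).1ᵀ = P.mat
    simp
  mul_smul g h P := by
    apply X.ext
    change (g * h).1 * P.mat * (g * h).1ᵀ = g.1 * (h.1 * P.mat * h.1ᵀ) * g.1ᵀ
    simp [Matrix.mul_assoc]

/-- The base point `o = [SO(3)]`. -/
def o : X where
  mat := 1
  posDef := Matrix.PosDef.one
  det_eq_one := Matrix.det_one

/-! ### The Riemannian metric induced by the Killing form -/

/-- The Riemannian norm of a tangent vector `V` (a symmetric matrix with `tr (P⁻¹ V) = 0`) at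
`P`. If `P = g gᵀ`, then `V` is the velocity at `s = 0` of `s ↦ g exp (s x) • o` for the traceless
symmetric matrix `x = (1/2) g⁻¹ V g⁻ᵀ`, and the norm of `V` is `√(B (x, x))` with the Killing form
`B (x, x) = 6 tr (x²)`; moreover `x` is conjugate to `(1/2) P⁻¹ V`. -/
def tangentNorm (P V : Matrix (Fin 3) (Fin 3) ℝ) : ℝ :=
  Real.sqrt (6 * (((1 / 2 : ℝ) • (P⁻¹ * V)) ^ 2).trace)

/-- A `C¹` curve in `X` that is at `p` at time `0` and at `q` at time `1`. (Only its restriction to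
`[0, 1]` matters.) -/
structure C1Curve (p q : X) : Type where
  toFun : ℝ → X
  contDiff : ∀ i j, ContDiff ℝ 1 fun t => (toFun t).mat i j
  source : toFun 0 = p
  target : toFun 1 = q

namespace C1Curve

variable {p q r : X}

/-- The velocity of a curve. -/
def velocity (γ : C1Curve p q) (t : ℝ) : Matrix (Fin 3) (Fin 3) ℝ :=
  Matrix.of fun i j => deriv (fun s => (γ.toFun s).mat i j) t

/-- The Riemannian speed of a curve. -/
def speed (γ : C1Curve p q) (t : ℝ) : ℝ :=
  tangentNorm (γ.toFun t).mat (γ.velocity t)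

/-- The Riemannian length of a curve on `[0, 1]`. -/
def length (γ : C1Curve p q) : ℝ := ∫ t in (0 : ℝ)..1, γ.speed t

end C1Curve

/-- The Riemannian distance: the infimum of the lengths of the `C¹` curves joining two points. -/
def riemEDist (p q : X) : ℝ≥0∞ := ⨅ γ : C1Curve p q, ENNReal.ofReal γ.length

/-! ### The Riemannian distance is a distance -/

namespace C1Curve

variable {p q r : X}

theorem tangentNorm_nonneg (P V : Matrix (Fin 3) (Fin 3) ℝ) : 0 ≤ tangentNorm P V :=
  Real.sqrt_nonneg _

theorem tangentNorm_smul (c : ℝ) (P V : Matrix (Fin 3) (Fin 3) ℝ) :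
    tangentNorm P (c • V) = |c| * tangentNorm P V := by
  unfold tangentNorm
  rw [← Real.sqrt_sq_eq_abs, ← Real.sqrt_mul (sq_nonneg c)]
  congr 1
  simp only [pow_two, Matrix.mul_smul, Matrix.smul_mul, Matrix.trace_smul, smul_eq_mul]
  ring

theorem tangentNorm_zero (P : Matrix (Fin 3) (Fin 3) ℝ) : tangentNorm P 0 = 0 := by
  simp [tangentNorm]

theorem continuous_mat (γ : C1Curve p q) : Continuous fun t => (γ.toFun t).mat :=
  continuous_matrix fun i j => (γ.contDiff i j).continuous

theorem continuous_velocity (γ : C1Curve p q) : Continuous γ.velocity :=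
  continuous_matrix fun i j => (γ.contDiff i j).continuous_deriv le_rfl

theorem continuous_speed (γ : C1Curve p q) : Continuous γ.speed := by
  have h : ∀ t, (γ.toFun t).mat⁻¹ = (γ.toFun t).mat.adjugate := fun t => by
    rw [Matrix.inv_def, (γ.toFun t).det_eq_one]; simp
  unfold speed tangentNorm
  simp only [h]
  have h1 := γ.continuous_mat.matrix_adjugate
  have h2 := ((h1.matrix_mul γ.continuous_velocity).const_smul (1 / 2 : ℝ)).pow 2
  exact (continuous_const.mul h2.matrix_trace).sqrt

theorem hasDerivAt (γ : C1Curve p q) (t : ℝ) (i j : Fin 3) :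
    HasDerivAt (fun s => (γ.toFun s).mat i j) (γ.velocity t i j) t :=
  ((γ.contDiff i j).differentiable one_ne_zero t).hasDerivAt

/-- The constant curve. -/
def const (p : X) : C1Curve p p where
  toFun _ := p
  contDiff _ _ := contDiff_const
  source := rfl
  target := rfl

theorem length_const (p : X) : (const p).length = 0 := by
  have h : ∀ t, (const p).velocity t = 0 := fun t => by
    ext i j
    simp [velocity, const]
  simp [length, speed, h, tangentNorm_zero]

/-- The reversed curve. -/
def symm (γ : C1Curve p q) : C1Curve q p where
  toFun t := γ.toFun (1 - t)
  contDiff i j := (γ.contDiff i j).comp (contDiff_const.sub contDiff_id)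
  source := by simpa using γ.target
  target := by simpa using γ.source

theorem length_symm (γ : C1Curve p q) : γ.symm.length = γ.length := by
  have h : ∀ t, γ.symm.speed t = γ.speed (1 - t) := fun t => by
    have hv : γ.symm.velocity t = (-1 : ℝ) • γ.velocity (1 - t) := by
      ext i j
      have h1 : HasDerivAt (fun s : ℝ => 1 - s) (-1) t := by
        simpa using (hasDerivAt_id t).const_sub 1
      have h2 := (γ.hasDerivAt (1 - t) i j).comp t h1
      have h3 := h2.deriv
      simp only [Matrix.smul_apply, smul_eq_mul]
      rw [mul_comm, ← h3]
      rfl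
    rw [speed, hv, tangentNorm_smul]
    simp [speed, symm]
  simp only [length, h]
  simp [intervalIntegral.integral_comp_sub_left]

theorem smooth_deriv_eq_zero {c d t : ℝ} (h : c * t + d < 0 ∨ 1 < c * t + d) :
    deriv (fun s => Real.smoothTransition (c * s + d)) t = 0 := by
  have hc : Continuous fun s : ℝ => c * s + d := by fun_prop
  rcases h with h | h
  · have : (fun s => Real.smoothTransition (c * s + d)) =ᶠ[𝓝 t] fun _ => (0 : ℝ) := by
      filter_upwards [hc.continuousAt.eventually (gt_mem_nhds h)] with s hs
      exact Real.smoothTransition.zero_of_nonpos hs.le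
    rw [this.deriv_eq]; simp
  · have : (fun s => Real.smoothTransition (c * s + d)) =ᶠ[𝓝 t] fun _ => (1 : ℝ) := by
      filter_upwards [hc.continuousAt.eventually (lt_mem_nhds h)] with s hs
      exact Real.smoothTransition.one_of_one_le hs.le
    rw [this.deriv_eq]; simp

theorem smooth_contDiff (c d : ℝ) :
    ContDiff ℝ 1 fun s => Real.smoothTransition (c * s + d) := by
  have := Real.smoothTransition.contDiff (n := 1)
  exact this.comp (by fun_prop)

theorem smooth_deriv_nonneg (d t : ℝ) :
    0 ≤ deriv (fun s => Real.smoothTransition (4 * s + d)) t := by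
  apply Monotone.deriv_nonneg
  intro a b hab
  exact Real.smoothTransition.monotone (by linarith)

/-- Concatenation of curves; both are slowed down to be constant near the junction. -/
def trans (γ : C1Curve p q) (δ : C1Curve q r) : C1Curve p r where
  toFun t := if t ≤ 1 / 2 then γ.toFun (Real.smoothTransition (4 * t + 0))
    else δ.toFun (Real.smoothTransition (4 * t + (-3)))
  contDiff i j := by
    have h : ContDiff ℝ 1 fun t => (γ.toFun (Real.smoothTransition (4 * t + 0))).mat i j
        + (δ.toFun (Real.smoothTransition (4 * t + (-3)))).mat i j - q.mat i j :=
      (((γ.contDiff i j).comp (smooth_contDiff 4 0)).add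
        ((δ.contDiff i j).comp (smooth_contDiff 4 (-3)))).sub contDiff_const
    convert h using 2 with t
    split_ifs with ht
    · rw [Real.smoothTransition.zero_of_nonpos (x := 4 * t + (-3)) (by linarith), δ.source]
      ring
    · rw [Real.smoothTransition.one_of_one_le (x := 4 * t + 0) (by linarith), γ.target]
      ring
  source := by simp [γ.source]
  target := by
    rw [if_neg (by norm_num), Real.smoothTransition.one_of_one_le (by norm_num), δ.target]

theorem length_trans (γ : C1Curve p q) (δ : C1Curve q r) :
    (γ.trans δ).length = γ.length + δ.length := by
  set φ : ℝ → ℝ := fun s => Real.smoothTransition (4 * s + 0) with hφ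
  set ψ : ℝ → ℝ := fun s => Real.smoothTransition (4 * s + (-3)) with hψ
  have hφd : ∀ t, HasDerivAt φ (deriv φ t) t := fun t =>
    ((smooth_contDiff 4 0).differentiable one_ne_zero t).hasDerivAt
  have hψd : ∀ t, HasDerivAt ψ (deriv ψ t) t := fun t =>
    ((smooth_contDiff 4 (-3)).differentiable one_ne_zero t).hasDerivAt
  have hφc : Continuous (deriv φ) := (smooth_contDiff 4 0).continuous_deriv le_rfl
  have hψc : Continuous (deriv ψ) := (smooth_contDiff 4 (-3)).continuous_deriv le_rfl
  have hvel : ∀ t, (γ.trans δ).velocity t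
      = deriv φ t • γ.velocity (φ t) + deriv ψ t • δ.velocity (ψ t) := fun t => by
    ext i j
    have h1 := (γ.hasDerivAt (φ t) i j).comp t (hφd t)
    have h2 := (δ.hasDerivAt (ψ t) i j).comp t (hψd t)
    have h3 := ((h1.add h2).sub_const (q.mat i j)).deriv
    have h4 : (fun s => ((γ.trans δ).toFun s).mat i j) = fun s =>
        (γ.toFun (φ s)).mat i j + (δ.toFun (ψ s)).mat i j - q.mat i j := by
      funext s
      simp only [trans]
      split_ifs with hs
      · rw [show ψ s = 0 from Real.smoothTransition.zero_of_nonpos (by linarith), δ.source]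
        simp [hφ]
      · rw [show φ s = 1 from Real.smoothTransition.one_of_one_le (by linarith), γ.target]
        simp [hψ]
    simp only [velocity, Matrix.of_apply, Matrix.add_apply, Matrix.smul_apply, smul_eq_mul] at h3 ⊢
    rw [h4, mul_comm (deriv φ t), mul_comm (deriv ψ t), ← h3]
    rfl
  have hspeed : ∀ t, (γ.trans δ).speed t
      = γ.speed (φ t) * deriv φ t + δ.speed (ψ t) * deriv ψ t := fun t => by
    unfold speed
    rw [hvel]
    by_cases ht : t ≤ 1 / 2
    · have h0 : deriv ψ t = 0 := smooth_deriv_eq_zero (Or.inl (by linarith))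
      have h1 : (γ.trans δ).toFun t = γ.toFun (φ t) := by simp only [trans, if_pos ht, hφ]
      rw [h0, h1, zero_smul, add_zero, tangentNorm_smul,
        abs_of_nonneg (smooth_deriv_nonneg 0 t)]
      ring
    · have h0 : deriv φ t = 0 := smooth_deriv_eq_zero (Or.inr (by linarith))
      have h1 : (γ.trans δ).toFun t = δ.toFun (ψ t) := by simp only [trans, if_neg ht, hψ]
      rw [h0, h1, zero_smul, zero_add, tangentNorm_smul,
        abs_of_nonneg (smooth_deriv_nonneg (-3) t)]
      ring
  have hφ' : Continuous φ := (smooth_contDiff 4 0).continuous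
  have hψ' : Continuous ψ := (smooth_contDiff 4 (-3)).continuous
  have i1 : ∫ t in (0 : ℝ)..1, γ.speed (φ t) * deriv φ t = γ.length := by
    have := intervalIntegral.integral_comp_mul_deriv (a := 0) (b := 1) (f := φ) (g := γ.speed)
      (fun t _ => hφd t) hφc.continuousOn γ.continuous_speed
    rw [show φ 0 = 0 from Real.smoothTransition.zero_of_nonpos (by norm_num),
      show φ 1 = 1 from Real.smoothTransition.one_of_one_le (by norm_num)] at this
    exact this
  have i2 : ∫ t in (0 : ℝ)..1, δ.speed (ψ t) * deriv ψ t = δ.length := by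
    have := intervalIntegral.integral_comp_mul_deriv (a := 0) (b := 1) (f := ψ) (g := δ.speed)
      (fun t _ => hψd t) hψc.continuousOn δ.continuous_speed
    rw [show ψ 0 = 0 from Real.smoothTransition.zero_of_nonpos (by norm_num),
      show ψ 1 = 1 from Real.smoothTransition.one_of_one_le (by norm_num)] at this
    exact this
  rw [length]
  simp only [hspeed]
  rw [intervalIntegral.integral_add, i1, i2]
  · exact ((γ.continuous_speed.comp hφ').mul hφc).intervalIntegrable _ _
  · exact ((δ.continuous_speed.comp hψ').mul hψc).intervalIntegrable _ _

end C1Curve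

/-- `X` with the Riemannian distance induced by the Killing form. -/
instance : PseudoEMetricSpace X where
  edist := riemEDist
  edist_self p := le_antisymm
    ((iInf_le _ (C1Curve.const p)).trans (by simp [C1Curve.length_const])) bot_le
  edist_comm := by
    have h : ∀ p q : X, riemEDist p q ≤ riemEDist q p := fun p q =>
      le_iInf fun γ => (iInf_le _ γ.symm).trans (by rw [C1Curve.length_symm])
    exact fun p q => le_antisymm (h p q) (h q p)
  edist_triangle p q r := by
    change riemEDist p r ≤ riemEDist p q + riemEDist q r
    unfold riemEDist
    simp only [ENNReal.iInf_add, ENNReal.add_iInf]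
    refine le_iInf fun δ => le_iInf fun γ => (iInf_le _ (γ.trans δ)).trans ?_
    rw [C1Curve.length_trans]
    exact ENNReal.ofReal_add_le

/-! ### The plane `Y`, its geodesics and the floating planes -/

/-- The matrix of the quadratic form `F (x, y, z) = 2 x z - y²`. -/
def J : Matrix (Fin 3) (Fin 3) ℝ := !![0, 0, 1; 0, -1, 0; 1, 0, 0]

/-- The special orthogonal group `SO(F)`. -/
def SOF : Subgroup G where
  carrier := {g | g.1ᵀ * J * g.1 = J}
  one_mem' := by simp
  mul_mem' {g h} hg hh := by
    simp only [Set.mem_ofPred_eq] at hg hh ⊢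
    rw [Matrix.SpecialLinearGroup.coe_mul, Matrix.transpose_mul]
    calc h.1ᵀ * g.1ᵀ * J * (g.1 * h.1) = h.1ᵀ * (g.1ᵀ * J * g.1) * h.1 := by
          simp only [Matrix.mul_assoc]
      _ = J := by rw [hg, hh]
  inv_mem' {g} hg := by
    simp only [Set.mem_ofPred_eq] at hg ⊢
    have h1 : g.1 * (g⁻¹).1 = 1 := by
      rw [← Matrix.SpecialLinearGroup.coe_mul, mul_inv_cancel, Matrix.SpecialLinearGroup.coe_one]
    have h2 : (g⁻¹).1ᵀ * g.1ᵀ = 1 := by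
      rw [← Matrix.transpose_mul, h1, Matrix.transpose_one]
    calc (g⁻¹).1ᵀ * J * (g⁻¹).1 = (g⁻¹).1ᵀ * (g.1ᵀ * J * g.1) * (g⁻¹).1 := by rw [hg]
      _ = ((g⁻¹).1ᵀ * g.1ᵀ) * J * (g.1 * (g⁻¹).1) := by simp only [Matrix.mul_assoc]
      _ = J := by rw [h1, h2, Matrix.one_mul, Matrix.mul_one]

/-- The group `H`, the identity component of `SO(F)`. -/
def H : Subgroup G := (Subgroup.connectedComponentOfOne SOF).map SOF.subtype

/-- The totally geodesic plane `Y = H o`. -/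
def Y : Set X := {x | ∃ h ∈ H, x = h • o}

/-- The positive diagonal matrices `A` of determinant one. -/
def A : Set G := {g | ∃ d : Fin 3 → ℝ, (∀ i, 0 < d i) ∧ g.1 = Matrix.diagonal d}

/-- `A₀ = H ∩ A`. -/
def A₀ : Set G := {g | g ∈ H ∧ g ∈ A}

/-- `a t = diag (e^t, e^(-2t), e^t)`. -/
def a (t : ℝ) : G :=
  ⟨Matrix.diagonal ![Real.exp t, Real.exp (-2 * t), Real.exp t], by
    rw [Matrix.det_diagonal, Fin.prod_univ_three]
    simp only [Matrix.cons_val]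
    rw [← Real.exp_add, ← Real.exp_add, ← Real.exp_zero]
    congr 1
    ring⟩

/-- A complete geodesic of the Hadamard manifold `X`: the image of an isometric embedding of `ℝ`
(a bi-infinite geodesic parametrised by arc length). -/
def IsCompleteGeodesic (L : Set X) : Prop := ∃ c : ℝ → X, Isometry c ∧ L = Set.range c

/-- The floating geodesic plane `Y_{L,t} = h a_t Y`, where `h ∈ H` is such that `L = h A₀ o`. As
`h a_t Y` does not depend on the choice of `h`, this is written as the union over all choices. -/
def floatingPlane (L : Set X) (t : ℝ) : Set X :=
  {x | ∃ h ∈ H, L = {z | ∃ g ∈ A₀, z = h • g • o} ∧ ∃ y ∈ Y, x = h • a t • y}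

/-- `y` is a point of `S` nearest to `x`. -/
def IsNearestPoint (S : Set X) (x y : X) : Prop := y ∈ S ∧ edist x y = Metric.infEDist x S

end FloatingPlane

end

namespace FloatingPlane

/-! The points of `Y` are the matrices y = 2vvᵀ - J with v on the hyperboloid F(v) = 1, unique up to
sign, and H acts on v linearly. In this model the nearest-point projection becomes linear algebra:
the point represented by v is the strict nearest point to x as soon as v is an eigenvector of xJ
(`edist_lt_of_eigenvector`), and such a v always exists (`exists_eigenvector`).

The criterion is proved at v = `vo`, y = `o`, where J `vo` = `vo`. A rotation of ℝ³ diagonalises x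
and J together and puts the eigenvalues of x in increasing order. The lower bound for the distance
comes from `le_edist`: the logarithms of the Cholesky pivots define a distance decreasing map to a
flat. After the rotation every point of `Y` has leading minors at least 1, so in the flat its image
lies farther from that of x than the image of `o` does.

For a point a_t y, with y represented by v, the eigenvector is (v₀, ρv₁, v₂), where ρ solves a
quadratic equation with 0 ≤ ρ ≤ 1 / cosh(3t) (`eigenvector_a_smul`, `exists_root`). After
normalisation its middle coordinate squared is at most 1/t², uniformly in y, and that coordinate
alone determines the distance to A₀o (`exists_eigenvector_close`). Conversely, if v₁ = 0 then v is
itself the eigenvector, so every point of A₀o is attained by the projection. By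
`exists_eq_smul_A₀_of_isCompleteGeodesic` and the equivariance under H this covers every L. -/

theorem smul_mat (g : G) (p : X) : (g • p).mat = g.1 * p.mat * g.1ᵀ := rfl

theorem X.inv_mat (p : X) : p.mat⁻¹ = p.mat.adjugate := by
  rw [Matrix.inv_def, p.det_eq_one]; simp

theorem X.transpose_mat (p : X) : p.matᵀ = p.mat := by
  simpa [Matrix.conjTranspose_eq_transpose_of_trivial] using p.posDef.isHermitian.eq

theorem X.mat_symm (p : X) (i j : Fin 3) : p.mat i j = p.mat j i :=
  congrFun (congrFun p.transpose_mat j) i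

/-! ### The group acts by isometries -/

/-- P⁻¹V is conjugated by gᵀ⁻¹, which leaves the trace of its square unchanged. -/
theorem tangentNorm_congr (g : G) (P V : Matrix (Fin 3) (Fin 3) ℝ) :
    tangentNorm (g.1 * P * g.1ᵀ) (g.1 * V * g.1ᵀ) = tangentNorm P V := by
  have hu : IsUnit g.1.det := by rw [g.2]; exact isUnit_one
  have hut : IsUnit g.1ᵀ.det := by rwa [Matrix.det_transpose]
  have h : (g.1 * P * g.1ᵀ)⁻¹ * (g.1 * V * g.1ᵀ) = g.1ᵀ⁻¹ * (P⁻¹ * V) * g.1ᵀ := by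
    rw [Matrix.mul_inv_rev, Matrix.mul_inv_rev]
    calc _ = g.1ᵀ⁻¹ * (P⁻¹ * ((g.1⁻¹ * g.1) * V) * g.1ᵀ) := by simp only [Matrix.mul_assoc]
      _ = _ := by
        rw [Matrix.nonsing_inv_mul _ hu, Matrix.one_mul]
        simp only [Matrix.mul_assoc]
  unfold tangentNorm
  congr 2
  rw [h, smul_pow, smul_pow, Matrix.trace_smul, Matrix.trace_smul, pow_two, pow_two]
  congr 1
  calc _ = (g.1ᵀ⁻¹ * ((P⁻¹ * V) * (g.1ᵀ * g.1ᵀ⁻¹) * (P⁻¹ * V) * g.1ᵀ)).trace := by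
        simp only [Matrix.mul_assoc]
    _ = _ := by
        rw [Matrix.trace_mul_comm, Matrix.mul_nonsing_inv _ hut, Matrix.mul_one, Matrix.mul_assoc,
          Matrix.mul_nonsing_inv _ hut, Matrix.mul_one, pow_two]

/-- The translate of a curve by a group element. -/
def C1Curve.translate {p q : X} (g : G) (γ : C1Curve p q) : C1Curve (g • p) (g • q) where
  toFun t := g • γ.toFun t
  contDiff i j := by
    have h := γ.contDiff
    simp only [smul_mat, Matrix.mul_apply]
    fun_prop
  source := by rw [γ.source]
  target := by rw [γ.target]

theorem C1Curve.length_translate {p q : X} (g : G) (γ : C1Curve p q) :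
    (γ.translate g).length = γ.length := by
  have hv : ∀ t, (γ.translate g).velocity t = g.1 * γ.velocity t * g.1ᵀ := fun t => by
    ext i j
    have h : HasDerivAt (fun s => ((γ.translate g).toFun s).mat i j)
        ((g.1 * γ.velocity t * g.1ᵀ) i j) t := by
      simp only [C1Curve.translate, smul_mat, Matrix.mul_apply]
      exact HasDerivAt.fun_sum fun k _ => (HasDerivAt.fun_sum fun l _ =>
        (γ.hasDerivAt t l k).const_mul _).mul_const _
    exact h.deriv
  have hs : ∀ t, (γ.translate g).speed t = γ.speed t := fun t => by
    rw [C1Curve.speed, hv]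
    exact tangentNorm_congr g _ _
  simp only [C1Curve.length, hs]

theorem edist_smul (g : G) (p q : X) : edist (g • p) (g • q) = edist p q := by
  have h : ∀ (g : G) (p q : X), edist (g • p) (g • q) ≤ edist p q := fun g p q =>
    le_iInf fun γ => (iInf_le _ (γ.translate g)).trans (by rw [C1Curve.length_translate])
  refine le_antisymm (h g p q) ?_
  simpa using h g⁻¹ (g • p) (g • q)

/-! ### The length of a one-parameter curve of diagonal matrices -/

/-- The point `diag (e^d₀, e^d₁, e^d₂)` of `X`. -/
noncomputable def expDiag (d : Fin 3 → ℝ) (hd : d 0 + d 1 + d 2 = 0) : X where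
  mat := Matrix.diagonal fun i => Real.exp (d i)
  posDef := Matrix.PosDef.diagonal fun i => Real.exp_pos _
  det_eq_one := by
    rw [Matrix.det_diagonal, Fin.prod_univ_three, ← Real.exp_add, ← Real.exp_add, hd,
      Real.exp_zero]

/-- The curve diag(e^{t dᵢ}) has constant speed, since P⁻¹V = diag(d) along it. Only this upper
bound is needed; the matching lower bound comes from `le_edist`. -/
theorem edist_o_expDiag_le (d : Fin 3 → ℝ) (hd : d 0 + d 1 + d 2 = 0) :
    edist o (expDiag d hd)
      ≤ ENNReal.ofReal (√6 / 2 * √(d 0 ^ 2 + d 1 ^ 2 + d 2 ^ 2)) := by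
  let γ : C1Curve o (expDiag d hd) :=
    { toFun := fun t => expDiag (fun i => t * d i) (by linear_combination t * hd)
      contDiff := fun i j => by
        simp only [expDiag, Matrix.diagonal_apply]
        split_ifs <;> fun_prop
      source := by ext i j; simp [expDiag, o]
      target := by ext i j; simp [expDiag] }
  refine (iInf_le _ γ).trans (ENNReal.ofReal_le_ofReal ?_)
  have hv : ∀ t, γ.velocity t = Matrix.diagonal fun i => Real.exp (t * d i) * d i := fun t => by
    ext i j
    refine HasDerivAt.deriv ?_
    simp only [γ, expDiag, Matrix.diagonal_apply]
    split_ifs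
    · simpa using ((hasDerivAt_id t).mul_const (d i)).exp
    · exact hasDerivAt_const _ _
  have hs : ∀ t, γ.speed t = √6 / 2 * √(d 0 ^ 2 + d 1 ^ 2 + d 2 ^ 2) := fun t => by
    have hinv : (γ.toFun t).mat⁻¹ = Matrix.diagonal fun i => Real.exp (-(t * d i)) := by
      refine Matrix.inv_eq_left_inv ?_
      simp only [γ, expDiag, Matrix.diagonal_mul_diagonal, ← Real.exp_add]
      simp
    have hprod : (γ.toFun t).mat⁻¹ * γ.velocity t = Matrix.diagonal d := by
      rw [hinv, hv, Matrix.diagonal_mul_diagonal]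
      congr 1
      funext i
      rw [← mul_assoc, ← Real.exp_add]
      simp
    rw [C1Curve.speed, tangentNorm, hprod, smul_pow, Matrix.diagonal_pow, Matrix.trace_smul,
      Matrix.trace_diagonal, Fin.sum_univ_three]
    have h4 : √(6 : ℝ) / 2 = √(6 / 4) := by
      rw [Real.sqrt_div (by norm_num), show (4 : ℝ) = 2 ^ 2 by norm_num,
        Real.sqrt_sq (by norm_num)]
    rw [h4, ← Real.sqrt_mul (by norm_num)]
    congr 1
    simp only [Pi.pow_apply, smul_eq_mul]
    ring
  simp [C1Curve.length, hs]

/-! ### The Iwasawa projection is distance decreasing -/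

/-- The leading principal `2 × 2` minor. -/
def minorTwo (P : Matrix (Fin 3) (Fin 3) ℝ) : ℝ := P 0 0 * P 1 1 - P 0 1 ^ 2

theorem X.minorTwo_eq (p : X) : minorTwo p.mat = p.mat⁻¹ 2 2 := by
  rw [p.inv_mat, Matrix.adjugate_fin_three]
  simp [minorTwo, p.mat_symm 1 0]
  ring

theorem X.minorTwo_pos (p : X) : 0 < minorTwo p.mat := by
  rw [p.minorTwo_eq]
  exact p.posDef.inv.diag_pos

theorem X.diag_pos (p : X) (i : Fin 3) : 0 < p.mat i i := p.posDef.diag_pos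

/-- In the coordinates of the Cholesky decomposition of `P`, the trace of `(P⁻¹ V)²` is a sum of
squares. -/
theorem sum_sq_le_trace (p : X) (V : Matrix (Fin 3) (Fin 3) ℝ) (hV : ∀ i j, V i j = V j i)
    (htr : (p.mat⁻¹ * V).trace = 0) :
    (V 0 0 / p.mat 0 0) ^ 2
      + ((V 0 0 * p.mat 1 1 + p.mat 0 0 * V 1 1 - 2 * p.mat 0 1 * V 0 1) / minorTwo p.mat
          - V 0 0 / p.mat 0 0) ^ 2
      + ((V 0 0 * p.mat 1 1 + p.mat 0 0 * V 1 1 - 2 * p.mat 0 1 * V 0 1) / minorTwo p.mat) ^ 2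
      ≤ ((p.mat⁻¹ * V) ^ 2).trace := by
  have hd₁ := p.diag_pos 0
  have hm := p.minorTwo_pos
  have hdet := p.det_eq_one
  rw [Matrix.det_fin_three, p.mat_symm 1 0, p.mat_symm 2 0, p.mat_symm 2 1] at hdet
  obtain ⟨d₁, hd₁'⟩ : ∃ d, d = p.mat 0 0 := ⟨_, rfl⟩
  obtain ⟨m, hm'⟩ : ∃ m, m = minorTwo p.mat := ⟨_, rfl⟩
  rw [← hd₁'] at hd₁
  rw [← hm'] at hm
  obtain ⟨a, ha⟩ : ∃ a, a = p.mat 0 1 / d₁ := ⟨_, rfl⟩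
  obtain ⟨b, hb⟩ : ∃ b, b = p.mat 0 2 / d₁ := ⟨_, rfl⟩
  obtain ⟨d₂, hd₂⟩ : ∃ d, d = m / d₁ := ⟨_, rfl⟩
  obtain ⟨c, hc⟩ : ∃ c, c = (p.mat 1 2 - d₁ * a * b) / d₂ := ⟨_, rfl⟩
  have hd₂pos : 0 < d₂ := hd₂ ▸ div_pos hm hd₁
  have p01 : p.mat 0 1 = d₁ * a := by rw [ha]; field_simp
  have p02 : p.mat 0 2 = d₁ * b := by rw [hb]; field_simp
  have hm2 : m = d₁ * d₂ := by rw [hd₂]; field_simp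
  have p12 : p.mat 1 2 = d₁ * a * b + d₂ * c := by rw [hc]; field_simp; ring
  have p11 : p.mat 1 1 = d₁ * a ^ 2 + d₂ := by
    have : d₁ * d₂ = d₁ * p.mat 1 1 - (d₁ * a) ^ 2 := by
      rw [← hm2, hm', minorTwo, ← hd₁', p01]
    apply mul_left_cancel₀ hd₁.ne'
    linear_combination -this
  have p22 : p.mat 2 2 = d₁ * b ^ 2 + d₂ * c ^ 2 + (d₁ * d₂)⁻¹ := by
    rw [← hd₁', p01, p02, p11, p12] at hdet
    field_simp
    linear_combination hdet
  -- N is the inverse of the unipotent lower triangular Cholesky factor of P, and E the inverse of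
  -- its pivots d₁, d₂, (d₁d₂)⁻¹. With W = N V Nᵀ the problem becomes one about the diagonal matrix
  -- E.
  let N : Matrix (Fin 3) (Fin 3) ℝ := !![1, 0, 0; -a, 1, 0; a * c - b, -c, 1]
  let E : Matrix (Fin 3) (Fin 3) ℝ := Matrix.diagonal ![d₁⁻¹, d₂⁻¹, d₁ * d₂]
  have hinv : p.mat⁻¹ = Nᵀ * E * N := by
    refine Matrix.inv_eq_left_inv ?_
    have hp : p.mat = !![d₁, d₁ * a, d₁ * b; d₁ * a, d₁ * a ^ 2 + d₂, d₁ * a * b + d₂ * c;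
        d₁ * b, d₁ * a * b + d₂ * c, d₁ * b ^ 2 + d₂ * c ^ 2 + (d₁ * d₂)⁻¹] := by
      ext i j
      fin_cases i <;> fin_cases j <;>
        simp [p01, p02, p12, p11, p22, ← hd₁', p.mat_symm 1 0, p.mat_symm 2 0, p.mat_symm 2 1]
    rw [hp]
    ext i j
    fin_cases i <;> fin_cases j <;>
      simp [N, E, Matrix.mul_apply, Fin.sum_univ_three, Matrix.diagonal_apply] <;>
      field_simp <;> ring
  set W := N * V * Nᵀ with hW
  have hWsymm : ∀ i j, W i j = W j i := fun i j => by
    have hVt : Vᵀ = V := by ext i j; exact hV j i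
    have : Wᵀ = W := by simp [hW, Matrix.transpose_mul, hVt, Matrix.mul_assoc]
    exact congrFun (congrFun this j) i
  have ht1 : (E * W).trace = 0 := by
    rw [← htr, hinv, hW]
    calc _ = (E * N * V * Nᵀ).trace := by simp only [Matrix.mul_assoc]
      _ = _ := by rw [Matrix.trace_mul_comm]; simp only [Matrix.mul_assoc]
  have ht2 : ((p.mat⁻¹ * V) ^ 2).trace = ((E * W) ^ 2).trace := by
    rw [hinv, hW, pow_two, pow_two]
    calc _ = (Nᵀ * (E * N * V * Nᵀ * E * N * V)).trace := by simp only [Matrix.mul_assoc]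
      _ = _ := by rw [Matrix.trace_mul_comm]; simp only [Matrix.mul_assoc]
  have w00 : W 0 0 = V 0 0 := by
    simp only [hW, Matrix.mul_apply, Fin.sum_univ_three]
    simp [N]
  have w11 : W 1 1 = V 1 1 - 2 * a * V 0 1 + a ^ 2 * V 0 0 := by
    simp only [hW, Matrix.mul_apply, Fin.sum_univ_three]
    simp [N, hV 1 0]
    ring
  have hs : (V 0 0 * p.mat 1 1 + p.mat 0 0 * V 1 1 - 2 * p.mat 0 1 * V 0 1) / minorTwo p.mat
      = W 0 0 / d₁ + W 1 1 / d₂ := by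
    rw [← hm', hm2, p11, ← hd₁', p01, w00, w11]
    field_simp
    ring
  have hr : V 0 0 / p.mat 0 0 = W 0 0 / d₁ := by rw [w00, hd₁']
  have h3 : W 0 0 / d₁ + W 1 1 / d₂ = - (d₁ * d₂ * W 2 2) := by
    simp [E, Matrix.trace, Fin.sum_univ_three] at ht1
    rw [div_eq_inv_mul, div_eq_inv_mul]
    linear_combination ht1
  rw [hs, hr, ht2]
  -- The trace is Σ EᵢEⱼWᵢⱼ². The diagonal terms are the squared logarithmic derivatives of the
  -- pivots; the off-diagonal ones are nonnegative and get dropped.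
  have hT : ((E * W) ^ 2).trace = (W 0 0 / d₁) ^ 2 + (W 1 1 / d₂) ^ 2 + (d₁ * d₂ * W 2 2) ^ 2
      + 2 * (W 0 1 ^ 2 / (d₁ * d₂)) + 2 * (d₂ * W 0 2 ^ 2) + 2 * (d₁ * W 1 2 ^ 2) := by
    simp [E, pow_two (Matrix.diagonal _ * W), Matrix.trace, Matrix.mul_apply, Fin.sum_univ_three,
      hWsymm 1 0, hWsymm 2 0, hWsymm 2 1, Matrix.diagonal_apply]
    field_simp
    ring
  rw [hT]
  have e1 : 0 ≤ W 0 1 ^ 2 / (d₁ * d₂) := by positivity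
  have e2 : 0 ≤ d₂ * W 0 2 ^ 2 := by positivity
  have e3 : 0 ≤ d₁ * W 1 2 ^ 2 := by positivity
  have e4 : (W 0 0 / d₁ + W 1 1 / d₂) ^ 2 = (d₁ * d₂ * W 2 2) ^ 2 := by rw [h3]; ring
  rw [add_sub_cancel_left, e4]
  linarith

theorem C1Curve.velocity_symm {p q : X} (γ : C1Curve p q) (t : ℝ) (i j : Fin 3) :
    γ.velocity t i j = γ.velocity t j i := by
  simp only [C1Curve.velocity, Matrix.of_apply, (γ.toFun _).mat_symm i j]

/-- This is the derivative of det = 1, written out by Jacobi's formula. -/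
theorem C1Curve.trace_velocity {p q : X} (γ : C1Curve p q) (t : ℝ) :
    ((γ.toFun t).mat⁻¹ * γ.velocity t).trace = 0 := by
  have h := γ.hasDerivAt t
  have h1 := ((((((((h 0 0).fun_mul (h 1 1)).fun_mul (h 2 2)).fun_sub
    (((h 0 0).fun_mul (h 1 2)).fun_mul (h 2 1))).fun_sub
    (((h 0 1).fun_mul (h 1 0)).fun_mul (h 2 2))).fun_add
    (((h 0 1).fun_mul (h 1 2)).fun_mul (h 2 0))).fun_add
    (((h 0 2).fun_mul (h 1 0)).fun_mul (h 2 1))).fun_sub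
    (((h 0 2).fun_mul (h 1 1)).fun_mul (h 2 0)))
  have h2 : HasDerivAt (fun s => (γ.toFun s).mat.det) 0 t := by
    simp only [(γ.toFun _).det_eq_one]
    exact hasDerivAt_const _ _
  simp only [Matrix.det_fin_three] at h2
  have h3 := h1.unique h2
  rw [X.inv_mat, Matrix.adjugate_fin_three]
  simp only [Matrix.trace, Matrix.diag_apply, Matrix.mul_apply, Fin.sum_univ_three]
  simp
  linear_combination h3

/-- The Iwasawa projection is distance decreasing. -/
theorem le_edist (p q : X) :
    ENNReal.ofReal (√6 / 2 * √((Real.log (q.mat 0 0) - Real.log (p.mat 0 0)) ^ 2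
      + ((Real.log (minorTwo q.mat) - Real.log (minorTwo p.mat))
          - (Real.log (q.mat 0 0) - Real.log (p.mat 0 0))) ^ 2
      + (Real.log (minorTwo q.mat) - Real.log (minorTwo p.mat)) ^ 2)) ≤ edist p q := by
  refine le_iInf fun γ => ENNReal.ofReal_le_ofReal ?_
  set u := Real.log (q.mat 0 0) - Real.log (p.mat 0 0) with hu
  set w := Real.log (minorTwo q.mat) - Real.log (minorTwo p.mat) with hw
  set n := √(u ^ 2 + (w - u) ^ 2 + w ^ 2) with hn
  have hn2 : n ^ 2 = u ^ 2 + (w - u) ^ 2 + w ^ 2 := Real.sq_sqrt (by positivity)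
  have hn0 : 0 ≤ n := Real.sqrt_nonneg _
  have hlen : 0 ≤ γ.length :=
    intervalIntegral.integral_nonneg (by norm_num) fun t _ => Real.sqrt_nonneg _
  rcases hn0.eq_or_lt with h0 | h0
  · rw [← h0]; simpa using hlen
  let r : ℝ → ℝ := fun t => γ.velocity t 0 0 / (γ.toFun t).mat 0 0
  let s : ℝ → ℝ := fun t => (γ.velocity t 0 0 * (γ.toFun t).mat 1 1
    + (γ.toFun t).mat 0 0 * γ.velocity t 1 1 - 2 * (γ.toFun t).mat 0 1 * γ.velocity t 0 1)
      / minorTwo (γ.toFun t).mat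
  -- A calibration: f' is the inner product of (u, w - u, -w), the total change of the log-pivots,
  -- with their velocity (r, s - r, -s). Hence f increases by n² in total, while Cauchy–Schwarz
  -- bounds f' by n times the norm of that velocity.
  let f : ℝ → ℝ := fun t => (2 * u - w) * Real.log ((γ.toFun t).mat 0 0)
    + (2 * w - u) * Real.log (minorTwo (γ.toFun t).mat)
  have hf : ∀ t, HasDerivAt f ((2 * u - w) * r t + (2 * w - u) * s t) t := fun t => by
    have h := γ.hasDerivAt t
    refine (((h 0 0).log ((γ.toFun t).diag_pos 0).ne').const_mul _).fun_add
      (HasDerivAt.const_mul _ ?_)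
    have h1 := ((h 0 0).fun_mul (h 1 1)).fun_sub ((h 0 1).fun_pow 2)
    have h2 := h1.log (γ.toFun t).minorTwo_pos.ne'
    refine h2.congr_deriv ?_
    simp only [s, minorTwo]
    congr 1
    push_cast
    ring
  have hcont : Continuous fun t => (2 * u - w) * r t + (2 * w - u) * s t := by
    have hm : ∀ i j, Continuous fun t => (γ.toFun t).mat i j := fun i j =>
      (γ.contDiff i j).continuous
    have hv : ∀ i j, Continuous fun t => γ.velocity t i j := fun i j =>
      γ.continuous_velocity.matrix_elem i j
    have hr : Continuous r := (hv 0 0).div (hm 0 0) fun t => ((γ.toFun t).diag_pos 0).ne'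
    have hs : Continuous s := by
      refine Continuous.div (by fun_prop) ?_ fun t => (γ.toFun t).minorTwo_pos.ne'
      simp only [minorTwo]
      fun_prop
    fun_prop
  have hint := intervalIntegral.integral_eq_sub_of_hasDerivAt (a := 0) (b := 1)
    (fun t _ => hf t) (hcont.intervalIntegrable _ _)
  have hends : f 1 - f 0 = n ^ 2 := by
    simp only [f, γ.source, γ.target]
    rw [hn2]
    linear_combination (w - 2 * u) * hu + (u - 2 * w) * hw
  have hle : ∀ t, √6 / 2 * ((2 * u - w) * r t + (2 * w - u) * s t) ≤ n * γ.speed t := fun t => by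
    have h1 := sum_sq_le_trace (γ.toFun t) (γ.velocity t) (γ.velocity_symm t)
      (γ.trace_velocity t)
    change r t ^ 2 + (s t - r t) ^ 2 + s t ^ 2 ≤ _ at h1
    rw [C1Curve.speed, tangentNorm, smul_pow, Matrix.trace_smul, smul_eq_mul]
    set T := (((γ.toFun t).mat⁻¹ * γ.velocity t) ^ 2).trace
    have hT : 0 ≤ T := le_trans (by positivity) h1
    refine le_trans (le_abs_self _) (abs_le_of_sq_le_sq ?_ (by positivity))
    have hcs : ((2 * u - w) * r t + (2 * w - u) * s t) ^ 2 ≤ n ^ 2 * T := by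
      refine le_trans ?_ (mul_le_mul_of_nonneg_left h1 (sq_nonneg n))
      rw [hn2]
      nlinarith [sq_nonneg (u * (s t - r t) - (w - u) * r t), sq_nonneg (u * s t - w * r t),
        sq_nonneg ((w - u) * s t - w * (s t - r t))]
    rw [mul_pow, mul_pow, div_pow, Real.sq_sqrt (show (0 : ℝ) ≤ 6 by norm_num),
      Real.sq_sqrt (show 0 ≤ 6 * ((1 / 2) ^ 2 * T) by positivity)]
    linarith
  have hmono := intervalIntegral.integral_mono_on (μ := MeasureTheory.volume)
    (a := 0) (b := 1) (by norm_num)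
    ((hcont.const_mul (√6 / 2)).intervalIntegrable _ _)
    ((γ.continuous_speed.const_mul n).intervalIntegrable _ _) fun t _ => hle t
  rw [intervalIntegral.integral_const_mul, intervalIntegral.integral_const_mul, hint,
    hends] at hmono
  change _ ≤ n * γ.length at hmono
  refine le_of_mul_le_mul_left ?_ h0
  linarith

/-! ### The group `H` and the hyperboloid model of `Y` -/

theorem J_mul_J : J * J = 1 := by
  ext i j
  fin_cases i <;> fin_cases j <;> simp [J, Matrix.mul_apply, Fin.sum_univ_three]

theorem J_transpose : Jᵀ = J := by
  ext i j
  fin_cases i <;> fin_cases j <;> simp [J]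

theorem mem_SOF {g : G} : g ∈ SOF ↔ g.1ᵀ * J * g.1 = J := Iff.rfl

theorem mul_J_mul_transpose {g : G} (hg : g ∈ SOF) : g.1 * J * g.1ᵀ = J := by
  have h1 : (J * g.1ᵀ * J) * g.1 = 1 := by
    calc (J * g.1ᵀ * J) * g.1 = J * (g.1ᵀ * J * g.1) := by simp only [Matrix.mul_assoc]
      _ = 1 := by rw [mem_SOF.1 hg, J_mul_J]
  have h2 := mul_eq_one_comm.1 h1
  calc g.1 * J * g.1ᵀ = (g.1 * (J * g.1ᵀ * J)) * J := by
        simp only [Matrix.mul_assoc, J_mul_J, Matrix.mul_one]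
    _ = J := by rw [h2, Matrix.one_mul]

theorem H_le_SOF : H ≤ SOF := by
  rintro _ ⟨g, -, rfl⟩
  exact g.2

/-- The range of a path in `SOF` through 1 is connected, so it lies in the identity component. -/
theorem mem_H_of_path (f : ℝ → Matrix (Fin 3) (Fin 3) ℝ) (hf : Continuous f)
    (hdet : ∀ s, (f s).det = 1) (hJ : ∀ s, (f s)ᵀ * J * f s = J) (h0 : f 0 = 1) (s : ℝ) :
    (⟨f s, hdet s⟩ : G) ∈ H := by
  let φ : ℝ → SOF := fun s => ⟨⟨f s, hdet s⟩, hJ s⟩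
  have hφ : Continuous φ := by
    refine Continuous.subtype_mk (Continuous.subtype_mk hf _) _
  have h1 : φ 0 = 1 := Subtype.ext (Subtype.ext h0)
  refine ⟨φ s, ?_, rfl⟩
  exact (isPreconnected_range hφ).subset_connectedComponent ⟨0, h1⟩ ⟨s, rfl⟩

/-- The quadratic form `F (x, y, z) = 2 x z - y²`. -/
def F (v : Fin 3 → ℝ) : ℝ := 2 * v 0 * v 2 - v 1 ^ 2

theorem F_eq_dotProduct (v : Fin 3 → ℝ) : F v = v ⬝ᵥ (J *ᵥ v) := by
  simp [F, J, dotProduct, Matrix.mulVec, Fin.sum_univ_three]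
  ring

theorem F_mulVec {g : G} (hg : g ∈ SOF) (v : Fin 3 → ℝ) : F (g.1 *ᵥ v) = F v := by
  rw [F_eq_dotProduct, F_eq_dotProduct, Matrix.dotProduct_mulVec, Matrix.vecMul_mulVec,
    ← Matrix.dotProduct_mulVec]
  conv_rhs => rw [← mem_SOF.1 hg]
  simp only [Matrix.mulVec_mulVec, Matrix.mul_assoc]

/-- The point `y` of `Y` corresponds to the point `v` of the hyperboloid `F = 1`. -/
def Represents (v : Fin 3 → ℝ) (y : X) : Prop :=
  F v = 1 ∧ y.mat = (2 : ℝ) • Matrix.vecMulVec v v - J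

/-- Both terms of 2vvᵀ - J transform correctly, because gJgᵀ = J for g in SO(F). -/
theorem Represents.smul {v : Fin 3 → ℝ} {y : X} (h : Represents v y) {g : G} (hg : g ∈ SOF) :
    Represents (g.1 *ᵥ v) (g • y) := by
  refine ⟨by rw [F_mulVec hg, h.1], ?_⟩
  rw [smul_mat, h.2, Matrix.mul_sub, Matrix.sub_mul, mul_J_mul_transpose hg, Matrix.mul_smul,
    Matrix.smul_mul, Matrix.mul_vecMulVec, Matrix.vecMulVec_mul, Matrix.vecMul_transpose]

theorem Represents.unique {v : Fin 3 → ℝ} {y y' : X} (h : Represents v y)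
    (h' : Represents v y') : y = y' := X.ext (h.2.trans h'.2.symm)

theorem Represents.neg {v : Fin 3 → ℝ} {y : X} (h : Represents v y) : Represents (-v) y := by
  refine ⟨by rw [← h.1]; simp [F], ?_⟩
  rw [h.2, Matrix.neg_vecMulVec, Matrix.vecMulVec_neg, neg_neg]

/-- The point of the hyperboloid corresponding to `o`. -/
noncomputable def vo : Fin 3 → ℝ := ![√2 / 2, 0, √2 / 2]

theorem sqrt_two_sq : √(2 : ℝ) ^ 2 = 2 := Real.sq_sqrt (by norm_num)

theorem represents_o : Represents vo o := by
  constructor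
  · simp [F, vo]
    linear_combination (1 / 2) * sqrt_two_sq
  · ext i j
    have h : 2 * (√(2 : ℝ) / 2 * (√2 / 2)) = 1 := by linear_combination (1 / 2) * sqrt_two_sq
    fin_cases i <;> fin_cases j <;> simp [o, vo, J, h]

/-- The one-parameter group `diag (e^s, 1, e^(-s))`. -/
noncomputable def boost (s : ℝ) : G :=
  ⟨Matrix.diagonal ![Real.exp s, 1, Real.exp (-s)], by
    rw [Matrix.det_diagonal, Fin.prod_univ_three]
    simp [← Real.exp_add]⟩

theorem boost_mem_H (s : ℝ) : boost s ∈ H := by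
  refine mem_H_of_path (fun s => Matrix.diagonal ![Real.exp s, 1, Real.exp (-s)]) ?_
    (fun s => (boost s).2) (fun s => ?_) ?_ s
  · refine Continuous.matrix_diagonal (continuous_pi fun i => ?_)
    fin_cases i <;> simp <;> fun_prop
  · ext i j
    fin_cases i <;> fin_cases j <;>
      simp [J, Matrix.mul_apply, Matrix.diagonal_apply, ← Real.exp_add]
  · ext i j
    fin_cases i <;> fin_cases j <;> simp

theorem boost_mulVec (s : ℝ) (v : Fin 3 → ℝ) :
    (boost s).1 *ᵥ v = ![Real.exp s * v 0, v 1, Real.exp (-s) * v 2] := by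
  ext i
  fin_cases i <;> simp [boost, Matrix.mulVec_diagonal]

theorem boost_inv (s : ℝ) : (boost s)⁻¹ = boost (-s) := by
  refine inv_eq_of_mul_eq_one_left (Subtype.ext ?_)
  rw [Matrix.SpecialLinearGroup.coe_mul, Matrix.SpecialLinearGroup.coe_one]
  simp only [boost, Matrix.diagonal_mul_diagonal]
  rw [← Matrix.diagonal_one]
  congr 1
  ext i
  fin_cases i <;> simp [← Real.exp_add]

/-- A one-parameter group of unipotent matrices. -/
noncomputable def unip (u : ℝ) : G :=
  ⟨!![1, u, u ^ 2 / 2; 0, 1, u; 0, 0, 1], by simp [Matrix.det_fin_three]⟩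

theorem unip_mem_H (u : ℝ) : unip u ∈ H := by
  refine mem_H_of_path (fun u => !![1, u, u ^ 2 / 2; 0, 1, u; 0, 0, 1]) ?_
    (fun u => (unip u).2) (fun u => ?_) ?_ u
  · refine continuous_matrix fun i j => ?_
    fin_cases i <;> fin_cases j <;> simp <;> fun_prop
  · ext i j
    fin_cases i <;> fin_cases j <;>
      simp [J, Matrix.mul_apply, Fin.sum_univ_three] <;> ring
  · ext i j
    fin_cases i <;> fin_cases j <;> simp

/-- The rotations around `o`. -/
noncomputable def rot (θ : ℝ) : G :=
  ⟨!![(1 + Real.cos θ) / 2, -(√2 / 2 * Real.sin θ), (1 - Real.cos θ) / 2;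
      √2 / 2 * Real.sin θ, Real.cos θ, -(√2 / 2 * Real.sin θ);
      (1 - Real.cos θ) / 2, √2 / 2 * Real.sin θ, (1 + Real.cos θ) / 2], by
    simp [Matrix.det_fin_three]
    linear_combination (1 / 2 * Real.sin θ ^ 2) * sqrt_two_sq + Real.sin_sq_add_cos_sq θ⟩

theorem rot_mem_H (θ : ℝ) : rot θ ∈ H := by
  refine mem_H_of_path (fun θ => (rot θ).1) ?_ (fun u => (rot u).2) (fun θ => ?_) ?_ θ
  · refine continuous_matrix fun i j => ?_
    fin_cases i <;> fin_cases j <;> simp [rot] <;> fun_prop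
  · have h := sqrt_two_sq
    have h' := Real.sin_sq_add_cos_sq θ
    ext i j
    fin_cases i <;> fin_cases j <;>
      simp [rot, J, Matrix.mul_apply, Fin.sum_univ_three] <;> grind
  · ext i j
    fin_cases i <;> fin_cases j <;> simp [rot]

theorem rot_mulVec_vo (θ : ℝ) : (rot θ).1 *ᵥ vo = vo := by
  ext i
  fin_cases i <;> simp [rot, vo, Matrix.mulVec, dotProduct, Fin.sum_univ_three] <;> ring

theorem rot_smul_o (θ : ℝ) : rot θ • o = o :=
  (rot_mulVec_vo θ ▸ represents_o.smul (H_le_SOF (rot_mem_H θ))).unique represents_o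

theorem exists_mem_H_mulVec_vo {v : Fin 3 → ℝ} (hF : F v = 1) (hv : 0 < v 2) :
    ∃ h ∈ H, h.1 *ᵥ vo = v := by
  -- The unipotent factor sets the middle coordinate to v₁; the boost keeps it and sets the last one
  -- to v₂. The first coordinate is then forced by F = 1.
  refine ⟨boost (-Real.log (√2 * v 2)) * unip (√2 * v 1),
    H.mul_mem (boost_mem_H _) (unip_mem_H _), ?_⟩
  have h2 : 0 < √(2 : ℝ) := by positivity
  have hs := sqrt_two_sq
  rw [Matrix.SpecialLinearGroup.coe_mul, ← Matrix.mulVec_mulVec, boost_mulVec, neg_neg,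
    Real.exp_neg, Real.exp_log (by positivity)]
  simp only [F] at hF
  ext i
  fin_cases i <;> simp [unip, vo, Matrix.mulVec, dotProduct, Fin.sum_univ_three]
  · field_simp
    grind
  · grind
  · grind

theorem Represents.apply_two_ne_zero {v : Fin 3 → ℝ} {y : X} (h : Represents v y) : v 2 ≠ 0 :=
  fun h0 => by
    have := h.1
    simp only [F, h0] at this
    nlinarith

theorem Represents.mem_Y {v : Fin 3 → ℝ} {y : X} (h : Represents v y) : y ∈ Y := by
  obtain ⟨w, hw, hpos⟩ : ∃ w, Represents w y ∧ 0 < w 2 := by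
    rcases h.apply_two_ne_zero.lt_or_gt with h0 | h0
    · exact ⟨-v, h.neg, by simpa using h0⟩
    · exact ⟨v, h, h0⟩
  obtain ⟨g, hg, hgv⟩ := exists_mem_H_mulVec_vo hw.1 hpos
  refine ⟨g, hg, hw.unique ?_⟩
  rw [← hgv]
  exact represents_o.smul (H_le_SOF hg)

theorem exists_represents {y : X} (hy : y ∈ Y) : ∃ v, 0 < v 0 ∧ 0 < v 2 ∧ Represents v y := by
  obtain ⟨g, hg, rfl⟩ := hy
  have h := represents_o.smul (H_le_SOF hg)
  set v := g.1 *ᵥ vo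
  have h1 := h.1
  simp only [F] at h1
  have h2 : 0 < v 0 * v 2 := by nlinarith [sq_nonneg (v 1)]
  rcases pos_and_pos_or_neg_and_neg_of_mul_pos h2 with h3 | h3
  · exact ⟨v, h3.1, h3.2, h⟩
  · exact ⟨-v, by simpa using h3.1, by simpa using h3.2, h.neg⟩

theorem smul_mem_Y {g : G} (hg : g ∈ SOF) {y : X} (hy : y ∈ Y) : g • y ∈ Y := by
  obtain ⟨v, -, -, hv⟩ := exists_represents hy
  exact (hv.smul hg).mem_Y

theorem exists_X_represents {v : Fin 3 → ℝ} (hF : F v = 1) (hv : 0 < v 2) :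
    ∃ y, Represents v y := by
  obtain ⟨g, hg, hgv⟩ := exists_mem_H_mulVec_vo hF hv
  exact ⟨g • o, hgv ▸ represents_o.smul (H_le_SOF hg)⟩

theorem mem_A₀_iff {g : G} : g ∈ A₀ ↔ ∃ s, g = boost s := by
  constructor
  · rintro ⟨hH, d, hd, hgd⟩
    have h := mem_SOF.1 (H_le_SOF hH)
    rw [hgd] at h
    have h02 := congrFun (congrFun h 0) 2
    have h11 := congrFun (congrFun h 1) 1
    simp [J, Matrix.mul_apply, Matrix.diagonal_apply] at h02 h11
    refine ⟨Real.log (d 0), Subtype.ext ?_⟩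
    rw [hgd]
    simp only [boost, Real.exp_neg, Real.exp_log (hd 0)]
    congr 1
    ext i
    fin_cases i
    · simp
    · have := hd 1
      simp
      nlinarith
    · simp
      exact eq_inv_of_mul_eq_one_right h02
  · rintro ⟨s, rfl⟩
    refine ⟨boost_mem_H s, ![Real.exp s, 1, Real.exp (-s)], fun i => ?_, rfl⟩
    fin_cases i <;> simp [Real.exp_pos]

/-! ### The nearest-point projection -/

/-- In log-pivot coordinates y is (α, β - α, -β) with α, β ≥ 0, a nonnegative combination of e₀ - e₁
and e₁ - e₂. Its inner product with the increasing vector d is at most 0, so d is strictly closer to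
0 than to that point. -/
theorem edist_expDiag_o_lt (d : Fin 3 → ℝ) (hd : d 0 + d 1 + d 2 = 0) (h01 : d 0 ≤ d 1)
    (h12 : d 1 ≤ d 2) (y : X) (h0 : 1 ≤ y.mat 0 0) (h1 : 1 ≤ minorTwo y.mat)
    (hne : y.mat 0 0 ≠ 1 ∨ minorTwo y.mat ≠ 1) :
    edist (expDiag d hd) o < edist (expDiag d hd) y := by
  have hα := Real.log_nonneg h0
  have hβ := Real.log_nonneg h1
  have hne' : Real.log (y.mat 0 0) ≠ 0 ∨ Real.log (minorTwo y.mat) ≠ 0 := by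
    refine hne.imp (fun h h' => h ?_) (fun h h' => h ?_)
    · exact Real.eq_one_of_pos_of_log_eq_zero (by linarith) h'
    · exact Real.eq_one_of_pos_of_log_eq_zero (by linarith) h'
  have e0 : Real.log ((expDiag d hd).mat 0 0) = d 0 := by simp [expDiag]
  have e1 : Real.log (minorTwo (expDiag d hd).mat) = -d 2 := by
    simp only [expDiag, minorTwo, Matrix.diagonal_apply]
    simp [← Real.exp_add]
    linarith
  have hlow := le_edist (expDiag d hd) y
  rw [e0, e1] at hlow
  rw [edist_comm]
  refine lt_of_le_of_lt (edist_o_expDiag_le d hd) (lt_of_lt_of_le ?_ hlow)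
  set α := Real.log (y.mat 0 0)
  set β := Real.log (minorTwo y.mat)
  have hpos : 0 < α ^ 2 + β ^ 2 := by
    rcases hne' with h | h <;> positivity
  have hkey : d 0 ^ 2 + d 1 ^ 2 + d 2 ^ 2
      < (α - d 0) ^ 2 + (β - -d 2 - (α - d 0)) ^ 2 + (β - -d 2) ^ 2 := by
    have e : (β - -d 2 - (α - d 0)) = β - α - d 1 := by linarith
    rw [e]
    nlinarith [mul_nonneg hα (sub_nonneg.2 h01), mul_nonneg hβ (sub_nonneg.2 h12),
      sq_nonneg (β - α)]
  have h6 : 0 < √(6 : ℝ) / 2 := by positivity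
  have hs := Real.sqrt_lt_sqrt (by positivity) hkey
  rw [ENNReal.ofReal_lt_ofReal_iff_of_nonneg (by positivity)]
  exact mul_lt_mul_of_pos_left hs h6

/-- If a rotation `r` diagonalises `J` and maps `x` to an ordered diagonal matrix, then `o` is the
nearest point of `Y` to `x`. -/
theorem edist_o_lt_of_diagonalizing (x : X) (r : Matrix (Fin 3) (Fin 3) ℝ) (hdet : r.det = 1)
    (hr : r * rᵀ = 1) (ε : Fin 3 → ℝ) (hrJ : r * J * rᵀ = Matrix.diagonal ε)
    (hε : ε = ![1, -1, -1] ∨ ε = ![-1, 1, -1] ∨ ε = ![-1, -1, 1])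
    (d : Fin 3 → ℝ) (hd : d 0 + d 1 + d 2 = 0) (h01 : d 0 ≤ d 1) (h12 : d 1 ≤ d 2)
    (hx : r * x.mat * rᵀ = Matrix.diagonal fun i => Real.exp (d i))
    (y : X) (hy : y ∈ Y) (hne : y ≠ o) : edist x o < edist x y := by
  obtain ⟨r, rfl⟩ : ∃ g : G, r = g.1 := ⟨⟨r, hdet⟩, rfl⟩
  replace hx : r • x = expDiag d hd := X.ext hx
  have hro : r • o = o := by
    apply X.ext
    rw [smul_mat]
    simpa [o] using hr
  have hne' : r • y ≠ o := fun h => hne (by rw [← hro] at h; exact smul_left_cancel _ h)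
  rw [← edist_smul r x o, ← edist_smul r x y, hro, hx]
  obtain ⟨v, -, -, hF, hv⟩ := exists_represents hy
  set w := r.1 *ᵥ v with hw
  have hmat : (r • y).mat = (2 : ℝ) • Matrix.vecMulVec w w - Matrix.diagonal ε := by
    rw [smul_mat, hv, Matrix.mul_sub, Matrix.sub_mul, hrJ, Matrix.mul_smul,
      Matrix.smul_mul, Matrix.mul_vecMulVec, Matrix.vecMulVec_mul, Matrix.vecMul_transpose]
  have hsum : ε 0 * w 0 ^ 2 + ε 1 * w 1 ^ 2 + ε 2 * w 2 ^ 2 = 1 := by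
    have h1 : r.1ᵀ * r.1 = 1 := mul_eq_one_comm.1 hr
    have h2 : r.1ᵀ *ᵥ w = v := by rw [hw, Matrix.mulVec_mulVec, h1, Matrix.one_mulVec]
    have h3 : w ⬝ᵥ (Matrix.diagonal ε *ᵥ w) = 1 := by
      rw [← hrJ, ← Matrix.mulVec_mulVec, ← Matrix.mulVec_mulVec, h2, Matrix.dotProduct_mulVec,
        ← Matrix.mulVec_transpose, h2, ← F_eq_dotProduct, hF]
    rw [← h3]
    simp [dotProduct, Matrix.mulVec_diagonal, Fin.sum_univ_three]
    ring
  have e00 : (r • y).mat 0 0 = 2 * w 0 ^ 2 - ε 0 := by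
    rw [hmat]; simp [Matrix.vecMulVec_apply]; ring
  have e11 : (r • y).mat 1 1 = 2 * w 1 ^ 2 - ε 1 := by
    rw [hmat]; simp [Matrix.vecMulVec_apply]; ring
  have e01 : (r • y).mat 0 1 = 2 * (w 0 * w 1) := by
    rw [hmat]; simp [Matrix.vecMulVec_apply]
  have hm : minorTwo (r • y).mat = ε 0 * ε 1 - 2 * ε 1 * w 0 ^ 2 - 2 * ε 0 * w 1 ^ 2 := by
    rw [minorTwo, e00, e11, e01]; ring
  have h_eq_o : ∀ i, ε i = 1 → (∀ j, j ≠ i → ε j = -1 ∧ w j = 0) → False := by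
    intro i hi hj
    apply hne'
    apply X.ext
    rw [hmat]
    have hwi : w i ^ 2 = 1 := by
      fin_cases i
      · have := hj 1 (by decide); have := hj 2 (by decide); simp_all
      · have := hj 0 (by decide); have := hj 2 (by decide); simp_all
      · have := hj 0 (by decide); have := hj 1 (by decide); simp_all
    ext j k
    by_cases hjk : j = k
    · subst hjk
      by_cases hji : j = i
      · subst hji
        simp [Matrix.vecMulVec_apply, o, hi]
        linarith
      · simp [Matrix.vecMulVec_apply, o, hj j hji]
    · rcases eq_or_ne j i with rfl | hji
      · simp [Matrix.vecMulVec_apply, o, hjk, hj k (Ne.symm hjk)]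
      · simp [Matrix.vecMulVec_apply, o, hjk, hj j hji]
  have sq0 : ∀ i, w i ^ 2 ≤ 0 → w i = 0 := fun i h =>
    pow_eq_zero_iff two_ne_zero |>.1 (le_antisymm h (sq_nonneg _))
  -- Substituting Σ εᵢwᵢ² = 1 writes both leading minors as 1 plus nonnegative multiples of squares,
  -- wherever the entry +1 of ε stands. If both equal 1, then w is ± a basis vector and the point is
  -- `o`.
  refine edist_expDiag_o_lt d hd h01 h12 _ ?_ ?_ ?_
  · rw [e00]
    rcases hε with rfl | rfl | rfl <;> simp at hsum ⊢ <;>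
      nlinarith [sq_nonneg (w 0), sq_nonneg (w 1), sq_nonneg (w 2)]
  · rw [hm]
    rcases hε with rfl | rfl | rfl <;> simp at hsum ⊢ <;>
      nlinarith [sq_nonneg (w 0), sq_nonneg (w 1), sq_nonneg (w 2)]
  · by_contra! hcon
    rw [e00, hm] at hcon
    obtain ⟨c0, c1⟩ := hcon
    have s0 := sq_nonneg (w 0)
    have s1 := sq_nonneg (w 1)
    have s2 := sq_nonneg (w 2)
    rcases hε with rfl | rfl | rfl <;> simp at hsum c0 c1
    · have z1 := sq0 1 (by nlinarith)
      have z2 := sq0 2 (by nlinarith)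
      exact h_eq_o 0 rfl fun j hj => by fin_cases j <;> simp_all
    · have z1 := sq0 0 (by nlinarith)
      have z2 := sq0 2 (by nlinarith)
      exact h_eq_o 1 rfl fun j hj => by fin_cases j <;> simp_all
    · have z1 := sq0 0 (by nlinarith)
      have z2 := sq0 1 (by nlinarith)
      exact h_eq_o 2 rfl fun j hj => by fin_cases j <;> simp_all

/-- The case of a point that is diagonal in the basis `(1, 0, 1)`, `(1, 0, -1)`, `(0, 1, 0)`. -/
theorem edist_o_lt_of_block (x : X) (μ a b : ℝ) (hab : a ≤ b)
    (hx : x.mat = !![(μ + a) / 2, 0, (μ - a) / 2; 0, b, 0; (μ - a) / 2, 0, (μ + a) / 2])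
    (y : X) (hy : y ∈ Y) (hne : y ≠ o) : edist x o < edist x y := by
  have hb : 0 < b := by have := x.diag_pos 1; simpa [hx] using this
  have hμa : 0 < μ + a := by have := x.diag_pos 0; simp [hx] at this; linarith
  have hdet : μ * a * b = 1 := by
    have := x.det_eq_one
    rw [hx, Matrix.det_fin_three] at this
    simp at this
    linarith
  have hμa' : 0 < μ * a := by
    by_contra! h
    nlinarith
  obtain ⟨hμ, ha⟩ : 0 < μ ∧ 0 < a := by
    rcases pos_and_pos_or_neg_and_neg_of_mul_pos hμa' with h | h
    · exact h
    · linarith [h.1, h.2]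
  have hlog : Real.log μ + Real.log a + Real.log b = 0 := by
    rw [← Real.log_mul hμ.ne' ha.ne', ← Real.log_mul hμa'.ne' hb.ne', hdet, Real.log_one]
  have hs := sqrt_two_sq
  have hlab := Real.log_le_log ha hab
  -- Since a ≤ b, the increasing order of the eigenvalues depends only on the position of μ, whose
  -- eigenvector is the +1 eigenvector of J. The rows of each rotation are the normalised
  -- eigenvectors in that order, with signs giving determinant 1.
  rcases le_total μ a with h1 | h1
  · refine edist_o_lt_of_diagonalizing x
      !![√2 / 2, 0, √2 / 2; √2 / 2, 0, -(√2 / 2); 0, 1, 0] ?_ ?_ ![1, -1, -1] ?_ (by simp)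
      ![Real.log μ, Real.log a, Real.log b] (by simpa using hlog)
      (by simpa using Real.log_le_log hμ h1) (by simpa using hlab) ?_ y hy hne
    · simp [Matrix.det_fin_three]; grind
    · ext i j
      fin_cases i <;> fin_cases j <;> simp [Matrix.mul_apply, Fin.sum_univ_three] <;> grind
    · ext i j
      fin_cases i <;> fin_cases j <;> simp [Matrix.mul_apply, Fin.sum_univ_three, J] <;> grind
    · ext i j
      rw [hx]
      fin_cases i <;> fin_cases j <;>
        simp [Matrix.mul_apply, Fin.sum_univ_three, Real.exp_log, hμ, ha, hb] <;> grind
  rcases le_total μ b with h2 | h2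
  · refine edist_o_lt_of_diagonalizing x
      !![√2 / 2, 0, -(√2 / 2); √2 / 2, 0, √2 / 2; 0, -1, 0] ?_ ?_ ![-1, 1, -1] ?_ (by simp)
      ![Real.log a, Real.log μ, Real.log b] (by simp; linarith)
      (by simpa using Real.log_le_log ha h1) (by simpa using Real.log_le_log hμ h2) ?_ y hy hne
    · simp [Matrix.det_fin_three]; grind
    · ext i j
      fin_cases i <;> fin_cases j <;> simp [Matrix.mul_apply, Fin.sum_univ_three] <;> grind
    · ext i j
      fin_cases i <;> fin_cases j <;> simp [Matrix.mul_apply, Fin.sum_univ_three, J] <;> grind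
    · ext i j
      rw [hx]
      fin_cases i <;> fin_cases j <;>
        simp [Matrix.mul_apply, Fin.sum_univ_three, Real.exp_log, hμ, ha, hb] <;> grind
  · refine edist_o_lt_of_diagonalizing x
      !![√2 / 2, 0, -(√2 / 2); 0, 1, 0; √2 / 2, 0, √2 / 2] ?_ ?_ ![-1, -1, 1] ?_ (by simp)
      ![Real.log a, Real.log b, Real.log μ] (by simp; linarith)
      (by simpa using hlab) (by simpa using Real.log_le_log hb h2) ?_ y hy hne
    · simp [Matrix.det_fin_three]; grind
    · ext i j
      fin_cases i <;> fin_cases j <;> simp [Matrix.mul_apply, Fin.sum_univ_three] <;> grind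
    · ext i j
      fin_cases i <;> fin_cases j <;> simp [Matrix.mul_apply, Fin.sum_univ_three, J] <;> grind
    · ext i j
      rw [hx]
      fin_cases i <;> fin_cases j <;>
        simp [Matrix.mul_apply, Fin.sum_univ_three, Real.exp_log, hμ, ha, hb] <;> grind

theorem mulVec_vo_iff (x : X) (μ : ℝ) : x.mat *ᵥ vo = μ • vo ↔
    x.mat 0 2 = μ - x.mat 0 0 ∧ x.mat 1 2 = -x.mat 0 1 ∧ x.mat 2 2 = x.mat 0 0 := by
  have h2 : √(2 : ℝ) / 2 ≠ 0 := by positivity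
  rw [funext_iff, Fin.forall_fin_succ, Fin.forall_fin_two]
  simp only [Matrix.mulVec, dotProduct, Fin.sum_univ_three, vo, Pi.smul_apply, smul_eq_mul]
  simp only [Fin.isValue, cons_val_zero, cons_val_one, cons_val, mul_zero, add_zero,
    Fin.succ_zero_eq_one, Fin.succ_one_eq_two, x.mat_symm 1 0, x.mat_symm 2 0, x.mat_symm 2 1,
    ← add_mul, mul_left_inj' h2]
  constructor
  · rintro ⟨h, h', h''⟩
    refine ⟨by linarith, ?_, by linarith⟩
    have := (mul_eq_zero.1 h').resolve_right h2
    linarith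
  · rintro ⟨h, h', h''⟩
    refine ⟨by linarith, ?_, by linarith⟩
    rw [h']; ring

/-- As `vo` is an eigenvector, x preserves the plane orthogonal to it. The stabiliser of `o` in H
rotates this plane, so it can diagonalise x there, which reduces the claim to `edist_o_lt_of_block`.
-/
theorem edist_o_lt_of_mulVec_vo (x : X) (μ : ℝ) (hx : x.mat *ᵥ vo = μ • vo)
    (y : X) (hy : y ∈ Y) (hne : y ≠ o) : edist x o < edist x y := by
  obtain ⟨x02, x12, x22⟩ := (mulVec_vo_iff x μ).1 hx
  -- In the basis (1, 0, -1)/√2, (0, 1, 0) of that plane, z consists of half the difference of the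
  -- diagonal entries of x and its off-diagonal entry. Rotating by half the argument of z kills the
  -- latter and makes the difference 2‖z‖ ≥ 0, which is the order a ≤ b.
  let z : ℂ := ⟨(x.mat 1 1 - (2 * x.mat 0 0 - μ)) / 2, √2 * x.mat 0 1⟩
  have hc : ‖z‖ * Real.cos z.arg = (x.mat 1 1 - (2 * x.mat 0 0 - μ)) / 2 :=
    Complex.norm_mul_cos_arg z
  have hs : ‖z‖ * Real.sin z.arg = √2 * x.mat 0 1 := Complex.norm_mul_sin_arg z
  obtain ⟨θ, hθ⟩ : ∃ θ, z.arg = 2 * θ := ⟨z.arg / 2, by ring⟩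
  rw [hθ, Real.cos_two_mul] at hc
  rw [hθ, Real.sin_two_mul] at hs
  have hz := norm_nonneg z
  have hsc := Real.sin_sq_add_cos_sq θ
  have h2 := sqrt_two_sq
  have hrt : (rot θ).1ᵀ *ᵥ vo = vo := by
    ext i
    fin_cases i <;> simp [rot, vo, Matrix.mulVec, dotProduct, Fin.sum_univ_three] <;> ring
  have hx' : (rot θ • x).mat *ᵥ vo = μ • vo := by
    rw [smul_mat, ← Matrix.mulVec_mulVec, hrt, ← Matrix.mulVec_mulVec, hx, Matrix.mulVec_smul,
      rot_mulVec_vo]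
  obtain ⟨x02', x12', x22'⟩ := (mulVec_vo_iff _ μ).1 hx'
  have x01' : (rot θ • x).mat 0 1 = 0 := by
    rw [smul_mat]
    simp only [Matrix.mul_apply, Fin.sum_univ_three, Matrix.transpose_apply, x.mat_symm 1 0,
      x.mat_symm 2 0, x.mat_symm 2 1, x02, x12, x22]
    simp [rot]
    grind
  have hle : 2 * (rot θ • x).mat 0 0 - μ ≤ (rot θ • x).mat 1 1 := by
    have h : (rot θ • x).mat 1 1 - (2 * (rot θ • x).mat 0 0 - μ) = 2 * ‖z‖ := by
      rw [smul_mat]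
      simp only [Matrix.mul_apply, Fin.sum_univ_three, Matrix.transpose_apply, x.mat_symm 1 0,
        x.mat_symm 2 0, x.mat_symm 2 1, x02, x12, x22]
      simp [rot]
      grind
    linarith
  have hy' : rot θ • y ∈ Y := smul_mem_Y (H_le_SOF (rot_mem_H θ)) hy
  have hne' : rot θ • y ≠ o := fun h => hne (by
    rw [← rot_smul_o θ] at h; exact smul_left_cancel _ h)
  rw [← edist_smul (rot θ) x o, ← edist_smul (rot θ) x y, rot_smul_o]
  refine edist_o_lt_of_block _ μ (2 * (rot θ • x).mat 0 0 - μ) ((rot θ • x).mat 1 1) hle ?_ _ hy'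
    hne'
  have hsym := (rot θ • x).mat_symm
  ext i j
  fin_cases i <;> fin_cases j <;>
    simp [hsym 1 0, hsym 2 0, hsym 2 1, x01', x02', x12', x22'] <;> ring

/-- The point of `Y` corresponding to an eigenvector `v` of `x J` is the nearest point to `x`. -/
theorem edist_lt_of_eigenvector {x y : X} {v : Fin 3 → ℝ} {μ : ℝ} (hv : Represents v y)
    (hx : (x.mat * J) *ᵥ v = μ • v) {y' : X} (hy' : y' ∈ Y) (hne : y' ≠ y) :
    edist x y < edist x y' := by
  wlog hpos : 0 < v 2 generalizing v
  · refine this hv.neg (by rw [Matrix.mulVec_neg, hx, smul_neg]) ?_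
    simpa using lt_of_le_of_ne (not_lt.1 hpos) hv.apply_two_ne_zero
  obtain ⟨g, hg, hgv⟩ := exists_mem_H_mulVec_vo hv.1 hpos
  have hgS := H_le_SOF hg
  have hy : g • o = y := (hgv ▸ represents_o.smul hgS).unique hv
  have hinv : g.1 * (g⁻¹).1 = 1 := by
    rw [← Matrix.SpecialLinearGroup.coe_mul, mul_inv_cancel, Matrix.SpecialLinearGroup.coe_one]
  have hinv' : (g⁻¹).1 * g.1 = 1 := mul_eq_one_comm.1 hinv
  have hJvo : J *ᵥ vo = vo := by
    ext i
    fin_cases i <;> simp [J, vo]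
  -- With J `vo` = `vo`, this identity turns the eigenvector v = g `vo` of xJ into the eigenvector
  -- `vo` of g⁻¹ • x.
  have hgJ : (g⁻¹).1ᵀ * J = J * g.1 := by
    calc (g⁻¹).1ᵀ * J = (g⁻¹).1ᵀ * (g.1ᵀ * J * g.1) := by rw [mem_SOF.1 hgS]
      _ = (g.1 * (g⁻¹).1)ᵀ * (J * g.1) := by
        rw [Matrix.transpose_mul]; simp only [Matrix.mul_assoc]
      _ = J * g.1 := by rw [hinv, Matrix.transpose_one, Matrix.one_mul]
  have hx' : (g⁻¹ • x).mat *ᵥ vo = μ • vo := by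
    rw [smul_mat, ← Matrix.mulVec_mulVec]
    conv_lhs => rw [← hJvo]
    rw [Matrix.mulVec_mulVec (M := (g⁻¹).1ᵀ), hgJ, ← Matrix.mulVec_mulVec (M := J), hgv,
      Matrix.mulVec_mulVec, Matrix.mul_assoc, ← Matrix.mulVec_mulVec, hx, Matrix.mulVec_smul,
      ← hgv, Matrix.mulVec_mulVec, hinv', Matrix.one_mulVec]
  have hyY : g⁻¹ • y' ∈ Y := smul_mem_Y (SOF.inv_mem hgS) hy'
  have h := edist_o_lt_of_mulVec_vo (g⁻¹ • x) μ hx' (g⁻¹ • y') hyY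
    (fun h => hne (by rw [← hy, ← h, smul_inv_smul]))
  rwa [← edist_smul g, ← edist_smul g (g⁻¹ • x), smul_inv_smul, smul_inv_smul, hy] at h

/-- Write x = BBᵀ. If w is an eigenvector of the symmetric matrix BᵀJB with eigenvalue μ, then Bw is
one of xJ, and F(Bw) = μ|w|². So a positive μ suffices, after scaling to F = 1. -/
theorem exists_eigenvector (x : X) :
    ∃ (y : X) (v : Fin 3 → ℝ) (μ : ℝ), Represents v y ∧ (x.mat * J) *ᵥ v = μ • v := by
  obtain ⟨B, hB⟩ : ∃ B : Matrix (Fin 3) (Fin 3) ℝ, x.mat = B * Bᵀ := by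
    open scoped MatrixOrder in
    have h0 : 0 ≤ x.mat := x.posDef.posSemidef.nonneg
    have h1 := (CFC.sqrt_nonneg x.mat).isSelfAdjoint.star_eq
    refine ⟨CFC.sqrt x.mat, ?_⟩
    rw [Matrix.star_eq_conjTranspose, Matrix.conjTranspose_eq_transpose_of_trivial] at h1
    rw [h1, CFC.sqrt_mul_sqrt_self x.mat h0]
  have hS : (-(Bᵀ * J * B)).IsHermitian := by
    rw [Matrix.IsHermitian, Matrix.conjTranspose_eq_transpose_of_trivial]
    simp [Matrix.transpose_mul, J_transpose, Matrix.mul_assoc]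
  have hBu : IsUnit B.det := by
    have := x.det_eq_one
    rw [hB, Matrix.det_mul] at this
    exact IsUnit.of_mul_eq_one _ this
  -- Otherwise -BᵀJB would be positive semidefinite; its value at B⁻¹`vo` is -F(`vo`) = -1.
  obtain ⟨i, hi⟩ : ∃ i, hS.eigenvalues i < 0 := by
    by_contra! hcon
    have hpsd := hS.posSemidef_iff_eigenvalues_nonneg.2 hcon
    have h := hpsd.dotProduct_mulVec_nonneg (B⁻¹ *ᵥ vo)
    have h1 : B *ᵥ (B⁻¹ *ᵥ vo) = vo := by
      rw [Matrix.mulVec_mulVec, Matrix.mul_nonsing_inv _ hBu, Matrix.one_mulVec]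
    rw [star_trivial, Matrix.neg_mulVec, dotProduct_neg, ← Matrix.mulVec_mulVec, h1,
      ← Matrix.mulVec_mulVec, Matrix.dotProduct_mulVec, ← Matrix.mulVec_transpose,
      Matrix.transpose_transpose, h1, ← F_eq_dotProduct, represents_o.1] at h
    linarith
  set w : Fin 3 → ℝ := (hS.eigenvectorBasis i).ofLp
  obtain ⟨μ, hμ⟩ : ∃ μ, μ = -hS.eigenvalues i := ⟨_, rfl⟩
  have hw : (Bᵀ * J * B) *ᵥ w = μ • w := by
    have h : -(Bᵀ * J * B) *ᵥ w = hS.eigenvalues i • w := hS.mulVec_eigenvectorBasis i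
    rw [hμ, neg_smul, ← h, Matrix.neg_mulVec, neg_neg]
  have hw0 : 0 < w ⬝ᵥ w := by
    have h1 : w ≠ 0 := fun h =>
      hS.eigenvectorBasis.orthonormal.ne_zero i (WithLp.ofLp_injective 2 h)
    exact lt_of_le_of_ne (Finset.sum_nonneg fun j _ => mul_self_nonneg (w j))
      (Ne.symm (dotProduct_self_eq_zero.not.2 h1))
  have hF : 0 < F (B *ᵥ w) := by
    rw [F_eq_dotProduct, Matrix.dotProduct_mulVec, Matrix.vecMul_mulVec,
      ← Matrix.dotProduct_mulVec, Matrix.mulVec_mulVec, hw, dotProduct_smul]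
    exact mul_pos (by linarith) hw0
  have hev : (x.mat * J) *ᵥ (B *ᵥ w) = μ • (B *ᵥ w) := by
    rw [hB, ← Matrix.mulVec_smul, ← hw]
    simp only [Matrix.mulVec_mulVec, Matrix.mul_assoc]
  set u := B *ᵥ w
  obtain ⟨c, hc0, hc⟩ : ∃ c : ℝ, c ≠ 0 ∧ c ^ 2 * F u = 1 :=
    ⟨(√(F u))⁻¹, (by positivity), by rw [inv_pow, Real.sq_sqrt hF.le, inv_mul_cancel₀ hF.ne']⟩
  have hFs : ∀ c : ℝ, F (c • u) = c ^ 2 * F u := fun c => by simp [F]; ring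
  have h2 : u 2 ≠ 0 := fun h2 => by
    simp only [F, h2] at hF
    nlinarith [sq_nonneg (u 1)]
  have hevs : ∀ c : ℝ, (x.mat * J) *ᵥ (c • u) = μ • (c • u) := fun c => by
    rw [Matrix.mulVec_smul, hev, smul_comm]
  rcases (mul_ne_zero hc0 h2).lt_or_gt with h | h
  · obtain ⟨y, hy⟩ := exists_X_represents (v := (-c) • u) (by rw [hFs, neg_sq, hc])
      (by simpa using h)
    exact ⟨y, _, μ, hy, hevs _⟩
  · obtain ⟨y, hy⟩ := exists_X_represents (v := c • u) (by rw [hFs, hc]) (by simpa using h)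
    exact ⟨y, _, μ, hy, hevs _⟩

/-! ### The distance on `Y` and its complete geodesics -/

theorem represents_boost_o (s : ℝ) :
    Represents ![Real.exp s * (√2 / 2), 0, Real.exp (-s) * (√2 / 2)] (boost s • o) := by
  have h := represents_o.smul (H_le_SOF (boost_mem_H s))
  rw [boost_mulVec] at h
  simpa [vo] using h

/-- The diagonal curve gives the upper bound and `le_edist` the lower one; for diagonal points they
agree. -/
theorem edist_o_boost_smul {s : ℝ} (hs : 0 ≤ s) :
    edist o (boost s • o) = ENNReal.ofReal (√3 * (2 * s)) := by
  have hb : boost s • o = expDiag ![2 * s, 0, -(2 * s)] (by simp) := by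
    apply X.ext
    rw [smul_mat]
    ext i j
    fin_cases i <;> fin_cases j <;>
      simp [boost, o, expDiag, Matrix.mul_apply, Matrix.diagonal_apply,
        ← Real.exp_add] <;> ring
  have hval : √6 / 2 * √((2 * s) ^ 2 + (0 : ℝ) ^ 2 + (2 * s) ^ 2) = √3 * (2 * s) := by
    have h1 : (2 * s) ^ 2 + (0 : ℝ) ^ 2 + (2 * s) ^ 2 = 2 * (2 * s) ^ 2 := by ring
    have h2 : √(6 : ℝ) = √3 * √2 := by rw [← Real.sqrt_mul (by norm_num)]; norm_num
    rw [h1, Real.sqrt_mul (by norm_num), Real.sqrt_sq (by linarith), h2]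
    linear_combination (√3 * s) * sqrt_two_sq
  apply le_antisymm
  · rw [hb, ← hval]
    refine (edist_o_expDiag_le _ _).trans (le_of_eq ?_)
    simp
  · refine le_trans (le_of_eq ?_) (le_edist o (boost s • o))
    rw [hb, ← hval]
    simp [o, expDiag, minorTwo]

theorem normSq_rot_mulVec (θ : ℝ) (v : Fin 3 → ℝ) :
    ((rot θ).1 *ᵥ v) ⬝ᵥ ((rot θ).1 *ᵥ v) = v ⬝ᵥ v := by
  have h : (rot θ).1ᵀ * (rot θ).1 = 1 := by
    have h := sqrt_two_sq
    have h' := Real.sin_sq_add_cos_sq θ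
    ext i j
    fin_cases i <;> fin_cases j <;>
      simp [rot, Matrix.mul_apply, Fin.sum_univ_three] <;> grind
  rw [Matrix.dotProduct_mulVec, Matrix.vecMul_mulVec, h, Matrix.vecMul_one]

/-- Polar coordinates around `o`: the rotations fix `vo` and turn the plane orthogonal to it, where
z records the position of v. The angle -arg z annihilates the middle coordinate and makes the first
at least the last, whence s ≥ 0. -/
theorem exists_rot_mulVec {v : Fin 3 → ℝ} (hF : F v = 1) (hv : 0 < v 2) :
    ∃ θ s, 0 ≤ s ∧
      (rot θ).1 *ᵥ v = ![Real.exp s * (√2 / 2), 0, Real.exp (-s) * (√2 / 2)] := by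
  have h2 := sqrt_two_sq
  have h2p : 0 < √(2 : ℝ) := by positivity
  let z : ℂ := ⟨√2 / 2 * (v 0 - v 2), v 1⟩
  have hc : ‖z‖ * Real.cos z.arg = √2 / 2 * (v 0 - v 2) := Complex.norm_mul_cos_arg z
  have hs : ‖z‖ * Real.sin z.arg = v 1 := Complex.norm_mul_sin_arg z
  have hz := norm_nonneg z
  have hsc := Real.sin_sq_add_cos_sq z.arg
  set w := (rot (-z.arg)).1 *ᵥ v with hw
  have hFw : F w = 1 := by rw [hw, F_mulVec (H_le_SOF (rot_mem_H _)), hF]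
  have w1 : w 1 = 0 := by
    simp [hw, rot, dotProduct, Fin.sum_univ_three]
    linear_combination Real.sin z.arg * hc - Real.cos z.arg * hs
  have w02 : w 0 - w 2 = √2 * ‖z‖ := by
    simp [hw, rot, dotProduct, Fin.sum_univ_three]
    grind
  have wsum : w 0 + w 2 = v 0 + v 2 := by
    simp [hw, rot, dotProduct, Fin.sum_univ_three]
    ring
  have hv0 : 0 < v 0 := by
    simp only [F] at hF
    by_contra! h
    nlinarith [sq_nonneg (v 1), mul_nonneg (neg_nonneg.2 h) hv.le]
  simp only [F, w1] at hFw
  have hle : w 2 ≤ w 0 := by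
    have : 0 ≤ √2 * ‖z‖ := by positivity
    linarith
  have hw0 : 0 < w 0 := by linarith
  have hpos : 0 < √2 * w 0 := by positivity
  have hge : 1 ≤ √2 * w 0 := by nlinarith
  refine ⟨-z.arg, Real.log (√2 * w 0), Real.log_nonneg hge, ?_⟩
  rw [Real.exp_neg, Real.exp_log hpos]
  ext i
  fin_cases i
  · simp
    linear_combination (-(w 0) / 2) * h2
  · simpa using w1
  · simp
    change w 2 = _
    field_simp
    linarith

theorem one_le_dotProduct_self {v : Fin 3 → ℝ} (hF : F v = 1) : 1 ≤ v ⬝ᵥ v := by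
  simp only [F] at hF
  simp only [dotProduct, Fin.sum_univ_three]
  nlinarith [sq_nonneg (v 0 - v 2), sq_nonneg (v 1)]

/-- Rotations preserve v ⬝ᵥ v, and `boost s • o`, at distance √3 · 2s, has v ⬝ᵥ v = cosh(2s). -/
theorem Represents.edist_o {v : Fin 3 → ℝ} {y : X} (h : Represents v y) :
    edist o y = ENNReal.ofReal (√3 * Real.arcosh (v ⬝ᵥ v)) := by
  wlog hpos : 0 < v 2 generalizing v
  · have := this h.neg (by
      simpa using lt_of_le_of_ne (not_lt.1 hpos) h.apply_two_ne_zero)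
    simpa using this
  obtain ⟨θ, s, hs, hθ⟩ := exists_rot_mulVec h.1 hpos
  have hy := h.smul (H_le_SOF (rot_mem_H θ))
  rw [hθ] at hy
  have hy' := hy.unique (represents_boost_o s)
  rw [← edist_smul (rot θ), rot_smul_o, hy', edist_o_boost_smul hs]
  have hn : v ⬝ᵥ v = Real.cosh (2 * s) := by
    rw [← normSq_rot_mulVec θ v, hθ, Real.cosh_eq, two_mul, neg_add, Real.exp_add, Real.exp_add]
    simp [dotProduct, Fin.sum_univ_three]
    linear_combination ((Real.exp s ^ 2 + Real.exp (-s) ^ 2) / 4) * sqrt_two_sq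
  rw [hn, Real.arcosh_cosh (by linarith)]

theorem Represents.dotProduct_self_eq {v : Fin 3 → ℝ} {y : X} (h : Represents v y) {r : ℝ}
    (hr : edist o y = ENNReal.ofReal (√3 * |r|)) : v ⬝ᵥ v = Real.cosh r := by
  have h1 := one_le_dotProduct_self h.1
  have h0 := Real.arcosh_nonneg h1
  rw [h.edist_o, ENNReal.ofReal_eq_ofReal_iff (by positivity) (by positivity)] at hr
  have := mul_left_cancel₀ (by positivity) hr
  rw [← Real.cosh_abs, ← this, Real.cosh_arcosh h1]

/-- A point of the hyperboloid is determined by its distances to two points of a geodesic, if the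
triangle is degenerate. -/
theorem eq_of_dotProduct_self_eq {v : Fin 3 → ℝ} {t : ℝ} (hF : F v = 1) (h0 : 0 < v 0)
    (h2 : 0 < v 2) (h : v ⬝ᵥ v = Real.cosh t)
    (h' : ((boost (-(1 / 2))).1 *ᵥ v) ⬝ᵥ ((boost (-(1 / 2))).1 *ᵥ v) = Real.cosh (t - 1)) :
    v = ![Real.exp (t / 2) * (√2 / 2), 0, Real.exp (-(t / 2)) * (√2 / 2)] := by
  obtain ⟨E, hE⟩ : ∃ E, E = Real.exp (1 / 2) := ⟨_, rfl⟩
  obtain ⟨S, hS⟩ : ∃ S, S = Real.exp (t / 2) := ⟨_, rfl⟩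
  have hE1 : 1 < E := by rw [hE]; simp
  have hS0 : 0 < S := hS ▸ Real.exp_pos _
  have ht : Real.exp t = S ^ 2 := by rw [hS, ← Real.exp_nat_mul]; congr 1; push_cast; ring
  have h1' : Real.exp 1 = E ^ 2 := by rw [hE, ← Real.exp_nat_mul]; congr 1; push_cast; ring
  rw [boost_mulVec, Real.cosh_eq, neg_neg, Real.exp_neg, neg_sub, Real.exp_sub, Real.exp_sub, ht,
    h1', ← hE] at h'
  rw [Real.cosh_eq, Real.exp_neg, ht] at h
  rw [Real.exp_neg, ← hS]
  simp only [dotProduct, Fin.sum_univ_three, F] at h h' hF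
  simp at h'
  obtain ⟨q, hq⟩ : ∃ q, q = v 1 ^ 2 := ⟨_, rfl⟩
  have hq0 : 0 ≤ q := hq ▸ sq_nonneg _
  have hEpos : 0 < E := by linarith
  obtain ⟨R, hR⟩ : ∃ R, R = S⁻¹ := ⟨_, rfl⟩
  have hSR : S * R = 1 := by rw [hR, mul_inv_cancel₀ hS0.ne']
  have hR0 : 0 < R := hR ▸ inv_pos.2 hS0
  have k1 : v 0 ^ 2 + q + v 2 ^ 2 = (S ^ 2 + R ^ 2) / 2 := by
    rw [hq, hR, inv_pow]
    linear_combination h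
  have k2 : v 0 ^ 2 + q * E ^ 2 + v 2 ^ 2 * E ^ 4 = (S ^ 2 + R ^ 2 * E ^ 4) / 2 := by
    rw [hq, hR, inv_pow]
    field_simp at h' ⊢
    linear_combination h'
  have hb : (v 2 ^ 2 - R ^ 2 / 2) * (E ^ 2 + 1) = -q := by
    have hE2 : E ^ 2 - 1 ≠ 0 := by nlinarith
    apply mul_left_cancel₀ hE2
    linear_combination k2 - k1
  have hble : v 2 ^ 2 ≤ R ^ 2 / 2 := by
    by_contra! hcon
    nlinarith [mul_pos (sub_pos.2 hcon) (show 0 < E ^ 2 + 1 by positivity)]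
  have hale : v 0 ^ 2 ≤ S ^ 2 / 2 := by
    by_contra! hcon
    nlinarith [mul_nonneg (sub_nonneg.2 hble) (sq_nonneg E)]
  -- The two distance equations give v₀² ≤ S²/2 and v₂² ≤ R²/2, hence v₀²v₂² ≤ 1/4. But F = 1 makes
  -- this product (1 + q)²/4, so q = 0.
  have hq00 : q = 0 := by
    have hprod := mul_le_mul hale hble (sq_nonneg _) (by positivity)
    have e1 : S ^ 2 / 2 * (R ^ 2 / 2) = 1 / 4 := by
      linear_combination (1 / 4) * (S * R + 1) * hSR
    have e2 : v 0 ^ 2 * v 2 ^ 2 = (1 + q) ^ 2 / 4 := by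
      have : v 0 * v 2 = (1 + q) / 2 := by rw [hq]; linarith
      rw [← mul_pow, this]; ring
    nlinarith
  rw [hq00] at hb k1 hq
  have hb' : v 2 ^ 2 = R ^ 2 / 2 := by
    have := (mul_eq_zero.1 (hb.trans neg_zero)).resolve_right (by positivity)
    linarith
  have hs2 := sqrt_two_sq
  have key : ∀ x y : ℝ, 0 < x → 0 < y → x ^ 2 = y ^ 2 / 2 → x = y * (√2 / 2) := by
    intro x y hx hy hxy
    rw [← sq_eq_sq₀ hx.le (by positivity), hxy]
    linear_combination (-(y ^ 2) / 4) * hs2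
  rw [← hR]
  ext i
  fin_cases i
  · have ha' : v 0 ^ 2 = S ^ 2 / 2 := by linarith
    exact key _ _ h0 hS0 ha'
  · simpa using hq.symm
  · exact key _ _ h2 hR0 hb'

/-- H moves c(0) to `o` and c(√3) to a point of A₀o. Every other point of the geodesic is then
determined by its distances to these two, by `eq_of_dotProduct_self_eq`. The factor √3 is the scale
of the metric of `Y` relative to arcosh. -/
theorem exists_eq_smul_A₀_of_isCompleteGeodesic {L : Set X} (hL : IsCompleteGeodesic L)
    (hLY : L ⊆ Y) : ∃ h ∈ H, L = {z | ∃ g ∈ A₀, z = h • g • o} := by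
  obtain ⟨c, hc, rfl⟩ := hL
  have hcY : ∀ t, c t ∈ Y := fun t => hLY ⟨t, rfl⟩
  have hdist : ∀ s t, edist (c (√3 * s)) (c (√3 * t)) = ENNReal.ofReal (√3 * |t - s|) := by
    intro s t
    rw [hc.edist_eq, edist_dist, dist_comm, Real.dist_eq, ← mul_sub, abs_mul,
      abs_of_nonneg (Real.sqrt_nonneg 3)]
  obtain ⟨h₀, hh₀, hc0⟩ := hcY (√3 * 0)
  have hh₀S := H_le_SOF hh₀
  obtain ⟨v₁, -, hv₁2, hv₁⟩ := exists_represents (smul_mem_Y (SOF.inv_mem hh₀S) (hcY (√3 * 1)))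
  obtain ⟨θ, s, hs, hθ⟩ := exists_rot_mulVec hv₁.1 hv₁2
  have hk := rot_mem_H θ
  have hy₁ : rot θ • h₀⁻¹ • c (√3 * 1) = boost s • o := by
    have := hv₁.smul (H_le_SOF hk)
    rw [hθ] at this
    exact this.unique (represents_boost_o s)
  set h := h₀ * (rot θ)⁻¹ with hh
  have hhH : h ∈ H := H.mul_mem hh₀ (H.inv_mem hk)
  have e0 : h⁻¹ • c (√3 * 0) = o := by
    rw [hc0, hh, _root_.mul_inv_rev, inv_inv, mul_smul, inv_smul_smul, rot_smul_o]
  have e1 : h⁻¹ • c (√3 * 1) = boost s • o := by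
    rw [hh, _root_.mul_inv_rev, inv_inv, mul_smul, hy₁]
  have hs2 : s = 1 / 2 := by
    have h1 := hdist 0 1
    rw [← edist_smul h⁻¹, e0, e1, edist_o_boost_smul hs,
      ENNReal.ofReal_eq_ofReal_iff (by positivity) (by positivity)] at h1
    have := mul_left_cancel₀ (by positivity) h1
    norm_num at this
    linarith
  have hmain : ∀ t, c (√3 * t) = h • boost (t / 2) • o := by
    intro t
    rw [← inv_smul_eq_iff]
    obtain ⟨v, hv0, hv2, hv⟩ :=
      exists_represents (smul_mem_Y (SOF.inv_mem (H_le_SOF hhH)) (hcY (√3 * t)))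
    have d0 := hdist 0 t
    rw [← edist_smul h⁻¹, e0, sub_zero] at d0
    have d1 := hdist 1 t
    rw [← edist_smul h⁻¹, e1, hs2, ← edist_smul (boost (1 / 2))⁻¹, inv_smul_smul, boost_inv] at d1
    have hv' := hv.smul (H_le_SOF (boost_mem_H (-(1 / 2))))
    have := eq_of_dotProduct_self_eq hv.1 hv0 hv2 (hv.dotProduct_self_eq d0)
      (hv'.dotProduct_self_eq d1)
    rw [this] at hv
    exact hv.unique (represents_boost_o _)
  refine ⟨h, hhH, ?_⟩
  ext z
  constructor
  · rintro ⟨t, rfl⟩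
    refine ⟨boost (t / √3 / 2), mem_A₀_iff.2 ⟨_, rfl⟩, ?_⟩
    rw [← hmain]
    congr 1
    field_simp
  · rintro ⟨g, hg, rfl⟩
    obtain ⟨s, rfl⟩ := mem_A₀_iff.1 hg
    exact ⟨√3 * (2 * s), by rw [hmain]; congr 3; ring⟩

/-! ### The projection of a floating plane -/

/-- a_t is scalar on the first and last coordinates, so only the middle coordinate of v has to
change. Rows 0 and 2 of the eigenvector equation both give the same μ, and row 1 becomes the
quadratic equation for ρ. -/
theorem eigenvector_a_smul {v : Fin 3 → ℝ} {y : X} (hv : Represents v y) {t ρ : ℝ}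
    (hρ : Real.cosh (3 * t) * ρ * (1 + 2 * v 1 ^ 2) = 1 + v 1 ^ 2 + ρ ^ 2 * v 1 ^ 2) :
    ∃ μ : ℝ, ((a t • y).mat * J) *ᵥ ![v 0, ρ * v 1, v 2] = μ • ![v 0, ρ * v 1, v 2] := by
  obtain ⟨E, hE⟩ : ∃ E, E = Real.exp t := ⟨_, rfl⟩
  have hE0 : 0 < E := hE ▸ Real.exp_pos _
  have h2 : Real.exp (-2 * t) = (E ^ 2)⁻¹ := by
    rw [hE, ← Real.exp_nat_mul, ← Real.exp_neg]; congr 1; push_cast; ring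
  have h3 : Real.exp (3 * t) = E ^ 3 := by
    rw [hE, ← Real.exp_nat_mul]; congr 1
  have hF := hv.1
  simp only [F] at hF
  rw [Real.cosh_eq, Real.exp_neg, h3] at hρ
  refine ⟨E ^ 2 * (1 + 2 * v 1 ^ 2) - 2 * E⁻¹ * v 1 ^ 2 * ρ, ?_⟩
  rw [smul_mat, hv.2, a]
  simp only [h2, ← hE]
  ext i
  fin_cases i
  all_goals
    simp [J, Matrix.mul_apply, Matrix.mulVec, dotProduct, Fin.sum_univ_three,
      Matrix.diagonal_apply, Matrix.vecMulVec_apply]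
    field_simp
    field_simp at hρ
  · linear_combination (2 * E ^ 3 * v 0) * hF
  · linear_combination (2 * E ^ 3 * v 1) * hF - v 1 * hρ
  · linear_combination (2 * E ^ 3 * v 2) * hF

theorem eigenvector_smul {x : X} {v : Fin 3 → ℝ} {μ : ℝ} (hx : (x.mat * J) *ᵥ v = μ • v) {h : G}
    (hh : h ∈ SOF) : ((h • x).mat * J) *ᵥ (h.1 *ᵥ v) = μ • (h.1 *ᵥ v) := by
  rw [← Matrix.mulVec_smul, ← hx, smul_mat, Matrix.mulVec_mulVec, Matrix.mulVec_mulVec]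
  congr 1
  calc _ = h.1 * x.mat * (h.1ᵀ * J * h.1) := by simp only [Matrix.mul_assoc]
    _ = _ := by rw [mem_SOF.1 hh, Matrix.mul_assoc]

/-- Intermediate values on [0, C⁻¹]: the difference of the two sides is -(1 + q) at 0 and q(1 - C⁻²)
≥ 0 at C⁻¹. Staying below C⁻¹ is what makes the middle coordinate small. -/
theorem exists_root {C q : ℝ} (hC : 1 ≤ C) (hq : 0 ≤ q) :
    ∃ ρ, 0 ≤ ρ ∧ C * ρ ≤ 1 ∧ C * ρ * (1 + 2 * q) = 1 + q + ρ ^ 2 * q := by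
  have hcont : ContinuousOn (fun ρ => C * ρ * (1 + 2 * q) - (1 + q + ρ ^ 2 * q))
      (Set.Icc 0 C⁻¹) := by fun_prop
  have hC0 : 0 < C := by linarith
  have h0 : C * 0 * (1 + 2 * q) - (1 + q + 0 ^ 2 * q) ≤ 0 := by nlinarith
  have h1 : 0 ≤ C * C⁻¹ * (1 + 2 * q) - (1 + q + C⁻¹ ^ 2 * q) := by
    rw [mul_inv_cancel₀ hC0.ne']
    have : C⁻¹ ^ 2 ≤ 1 := pow_le_one₀ (by positivity) (inv_le_one_of_one_le₀ hC)
    nlinarith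
  obtain ⟨ρ, hρ, h⟩ := intermediate_value_Icc (by positivity) hcont ⟨h0, h1⟩
  refine ⟨ρ, hρ.1, ?_, by simpa [sub_eq_zero] using h⟩
  calc C * ρ ≤ C * C⁻¹ := mul_le_mul_of_nonneg_left hρ.2 hC0.le
    _ = 1 := mul_inv_cancel₀ hC0.ne'

theorem sq_le_cosh_sq_sub_one (t : ℝ) : t ^ 2 ≤ Real.cosh (3 * t) ^ 2 - 1 := by
  rw [Real.cosh_sq, add_sub_cancel_right, ← sq_abs, ← sq_abs (Real.sinh _), Real.abs_sinh]
  refine pow_le_pow_left₀ (abs_nonneg t) ?_ 2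
  refine le_trans ?_ (Real.self_le_sinh_iff.2 (abs_nonneg _))
  rw [abs_mul, abs_of_pos (by norm_num : (0 : ℝ) < 3)]
  linarith [abs_nonneg t]

/-- The projection of a point of `a t • Y` is close to the geodesic `A₀ o`. -/
theorem exists_eigenvector_close {y : X} (hy : y ∈ Y) {t : ℝ} (ht : t ≠ 0) :
    ∃ (y₁ : X) (u : Fin 3 → ℝ) (μ s : ℝ), Represents u y₁ ∧
      ((a t • y).mat * J) *ᵥ u = μ • u ∧
      edist y₁ (boost s • o) ≤ ENNReal.ofReal (√3 * Real.arcosh (1 + 2 / |t| ^ 2)) := by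
  obtain ⟨v, hv0, hv2, hv⟩ := exists_represents hy
  obtain ⟨ρ, hρ0, hρ1, hρ⟩ := exists_root (Real.one_le_cosh (3 * t)) (sq_nonneg (v 1))
  obtain ⟨μ, hμ⟩ := eigenvector_a_smul hv hρ
  have hF := hv.1
  simp only [F] at hF
  have hC := Real.one_le_cosh (3 * t)
  have hCt := sq_le_cosh_sq_sub_one t
  have ht2 : 0 < t ^ 2 := by positivity
  -- N is F(v₀, ρv₁, v₂), the normalising factor. The next bound combines t² ≤ cosh²(3t) - 1 with
  -- (cosh(3t) ρ)² ≤ 1, and does not depend on y.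
  obtain ⟨N, hN⟩ : ∃ N, N = 1 + v 1 ^ 2 - ρ ^ 2 * v 1 ^ 2 := ⟨_, rfl⟩
  have hbound : ρ ^ 2 * v 1 ^ 2 * t ^ 2 ≤ N := by
    have h1 : (Real.cosh (3 * t) * ρ) ^ 2 ≤ 1 := pow_le_one₀ (by positivity) hρ1
    have h2 : ρ ^ 2 * v 1 ^ 2 * t ^ 2 ≤ ρ ^ 2 * v 1 ^ 2 * (Real.cosh (3 * t) ^ 2 - 1) :=
      mul_le_mul_of_nonneg_left hCt (by positivity)
    have h3 := mul_le_mul_of_nonneg_right h1 (sq_nonneg (v 1))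
    nlinarith
  have hNpos : 0 < N := by
    have h1 : ρ ^ 2 ≤ 1 := pow_le_one₀ hρ0 (by nlinarith)
    have h3 := mul_le_mul_of_nonneg_right h1 (sq_nonneg (v 1))
    linarith
  have hsq : √N ^ 2 = N := Real.sq_sqrt hNpos.le
  have hsN : 0 < √N := Real.sqrt_pos.2 hNpos
  set u : Fin 3 → ℝ := (√N)⁻¹ • ![v 0, ρ * v 1, v 2] with hu
  have u0 : u 0 = (√N)⁻¹ * v 0 := rfl
  have u1 : u 1 = (√N)⁻¹ * (ρ * v 1) := rfl
  have u2 : u 2 = (√N)⁻¹ * v 2 := rfl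
  have hu0 : 0 < u 0 := by rw [u0]; positivity
  have hu2 : 0 < u 2 := by rw [u2]; positivity
  have hFu : F u = 1 := by
    simp only [F, u0, u1, u2]
    field_simp
    rw [hsq, hN]
    linear_combination hF
  have hu1 : u 1 ^ 2 ≤ 1 / |t| ^ 2 := by
    rw [u1, mul_pow, inv_pow, hsq, sq_abs, mul_pow, inv_mul_eq_div, div_le_div_iff₀ hNpos ht2]
    linarith
  obtain ⟨y₁, hy₁⟩ := exists_X_represents hFu hu2
  -- The inverse boost by this s makes the first and last coordinates of u equal. Their squares then
  -- sum to 2u₀u₂ = 1 + u₁², so the squared norm is 1 + 2u₁².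
  refine ⟨y₁, u, μ, Real.log (u 0 / u 2) / 2, hy₁, ?_, ?_⟩
  · rw [hu, Matrix.mulVec_smul, hμ, smul_comm]
  · have hr := hy₁.smul (H_le_SOF (boost_mem_H (-(Real.log (u 0 / u 2) / 2))))
    rw [← edist_smul (boost (Real.log (u 0 / u 2) / 2))⁻¹, inv_smul_smul, boost_inv, edist_comm,
      hr.edist_o]
    refine ENNReal.ofReal_le_ofReal (mul_le_mul_of_nonneg_left ?_ (Real.sqrt_nonneg 3))
    have hdot : ((boost (-(Real.log (u 0 / u 2) / 2))).1 *ᵥ u) ⬝ᵥ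
        ((boost (-(Real.log (u 0 / u 2) / 2))).1 *ᵥ u) = 1 + 2 * u 1 ^ 2 := by
      obtain ⟨e, he⟩ : ∃ e, e = Real.exp (Real.log (u 0 / u 2) / 2) := ⟨_, rfl⟩
      have he0 : 0 < e := he ▸ Real.exp_pos _
      have he2 : e ^ 2 * u 2 = u 0 := by
        rw [he, ← Real.exp_nat_mul]
        push_cast
        rw [mul_div_cancel₀ _ two_ne_zero, Real.exp_log (by positivity)]
        field_simp
      rw [boost_mulVec, neg_neg, Real.exp_neg, ← he]
      simp only [F] at hFu
      simp [dotProduct, Fin.sum_univ_three]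
      rw [← he2] at hFu ⊢
      field_simp
      linear_combination hFu
    rw [hdot]
    have hp : 0 < 1 + 2 * u 1 ^ 2 := by positivity
    have hp' : 0 < 1 + 2 / |t| ^ 2 := by positivity
    rw [Real.arcosh_le_arcosh hp hp']
    have : 2 / |t| ^ 2 = 2 * (1 / |t| ^ 2) := by ring
    linarith

/-! ### Passage to the limit -/

theorem tendsto_bound :
    Tendsto (fun t : ℝ => ENNReal.ofReal (√3 * Real.arcosh (1 + 2 / |t| ^ 2)))
      (comap (fun t : ℝ => |t|) atTop) (𝓝 0) := by
  have h1 : Tendsto (fun r : ℝ => 1 + 2 / r ^ 2) atTop (𝓝[Set.Ici 1] 1) := by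
    refine tendsto_nhdsWithin_iff.2 ⟨?_, Eventually.of_forall fun r => ?_⟩
    · have := (tendsto_const_nhds (x := (2 : ℝ))).div_atTop
        (tendsto_pow_atTop (α := ℝ) (n := 2) two_ne_zero)
      simpa using this.const_add 1
    · have : 0 ≤ 2 / r ^ 2 := by positivity
      simpa using this
  have h2 : Tendsto Real.arcosh (𝓝[Set.Ici 1] 1) (𝓝 0) := by
    have := Real.continuousOn_arcosh 1 (by simp)
    rw [ContinuousWithinAt, (Real.arcosh_eq_zero_iff le_rfl).2 rfl] at this
    exact this
  have h3 := ENNReal.tendsto_ofReal ((h2.comp h1).const_mul √3)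
  rw [mul_zero, ENNReal.ofReal_zero] at h3
  exact h3.comp tendsto_comap

/-- Strictness in `edist_lt_of_eigenvector` makes the choice of π canonical: any eigenvector of xJ
on the hyperboloid computes π x. The Hausdorff distance is then at most the bound of
`exists_eigenvector_close`. -/
theorem exists_projection_tendsto_hausdorffEDist :
    ∃ π : X → X, (∀ x y, IsNearestPoint Y x y ↔ y = π x) ∧
      ∀ L : Set X, IsCompleteGeodesic L → L ⊆ Y → Tendsto (fun t : ℝ => Metric.hausdorffEDist (π '' floatingPlane L t) L)
          (comap (fun t : ℝ => |t|) atTop) (𝓝 0) := by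
  choose π w ν hπ hν using exists_eigenvector
  have hlt : ∀ x, ∀ y ∈ Y, y ≠ π x → edist x (π x) < edist x y := fun x y hy hne =>
    edist_lt_of_eigenvector (hπ x) (hν x) hy hne
  have hunique : ∀ {x y : X} {v : Fin 3 → ℝ} {μ : ℝ}, Represents v y →
      (x.mat * J) *ᵥ v = μ • v → π x = y := by
    intro x y v μ hv hx
    by_contra hne
    exact lt_asymm (hlt x y hv.mem_Y (Ne.symm hne))
      (edist_lt_of_eigenvector hv hx (hπ x).mem_Y hne)
  have hinf : ∀ x, Metric.infEDist x Y = edist x (π x) := fun x =>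
    le_antisymm (Metric.infEDist_le_edist_of_mem (hπ x).mem_Y)
      (Metric.le_infEDist.2 fun y hy => by
        by_cases h : y = π x
        · rw [h]
        · exact (hlt x y hy h).le)
  refine ⟨π, fun x y => ⟨fun h => ?_, ?_⟩, fun L hL hLY => ?_⟩
  · by_contra hne
    have := hlt x y h.1 hne
    rw [h.2, hinf] at this
    exact lt_irrefl _ this
  · rintro rfl
    exact ⟨(hπ x).mem_Y, (hinf x).symm⟩
  obtain ⟨h, hh, hLh⟩ := exists_eq_smul_A₀_of_isCompleteGeodesic hL hLY
  refine tendsto_of_tendsto_of_tendsto_of_le_of_le' tendsto_const_nhds tendsto_bound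
    (Eventually.of_forall fun _ => bot_le) ?_
  have hev : ∀ᶠ t : ℝ in comap (fun t : ℝ => |t|) atTop, t ≠ 0 := by
    filter_upwards [tendsto_comap.eventually (eventually_gt_atTop 0)] with t ht
    exact abs_pos.1 ht
  filter_upwards [hev] with t ht
  refine Metric.hausdorffEDist_le_of_mem_edist ?_ ?_
  -- The element k need not be the chosen h, but it also satisfies L = k A₀ o, so k • `boost s` •
  -- `o` is a point of L.
  · rintro _ ⟨_, ⟨k, hk, hLk, y, hy, rfl⟩, rfl⟩
    obtain ⟨y₁, u, μ, s, hu, hμ, hd⟩ := exists_eigenvector_close hy ht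
    have hkS := H_le_SOF hk
    rw [hunique (hu.smul hkS) (eigenvector_smul hμ hkS)]
    refine ⟨k • boost s • o, ?_, by rwa [edist_smul]⟩
    rw [hLk]
    exact ⟨boost s, mem_A₀_iff.2 ⟨s, rfl⟩, rfl⟩
  · intro z hz
    rw [hLh] at hz
    obtain ⟨g, hg, rfl⟩ := hz
    obtain ⟨s, rfl⟩ := mem_A₀_iff.1 hg
    have hhS := H_le_SOF hh
    have hs := represents_boost_o s
    -- This point of L is its own approximation: it is the projection of h a_t `boost s` `o`, since
    -- for v₁ = 0 the vector v is unchanged and the equation for ρ reduces to cosh(3t) ρ = 1.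
    refine ⟨h • boost s • o, ⟨h • a t • boost s • o,
      ⟨h, hh, hLh, boost s • o, ⟨boost s, boost_mem_H s, rfl⟩, rfl⟩, ?_⟩, by simp⟩
    obtain ⟨μ, hμ⟩ := eigenvector_a_smul hs (t := t) (ρ := (Real.cosh (3 * t))⁻¹) (by
      simp [(Real.cosh_pos (3 * t)).ne'])
    refine hunique (hs.smul hhS) (eigenvector_smul (μ := μ) ?_ hhS)
    simpa using hμ

end FloatingPlane

theorem mainTheorem4 :
    ∃ π : FloatingPlane.X → FloatingPlane.X,
      (∀ x y, FloatingPlane.IsNearestPoint FloatingPlane.Y x y ↔ y = π x) ∧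
      ∀ L : Set FloatingPlane.X, FloatingPlane.IsCompleteGeodesic L → L ⊆ FloatingPlane.Y →
        Tendsto (fun t : ℝ => Metric.hausdorffEDist (π '' FloatingPlane.floatingPlane L t) L)
          (comap (fun t : ℝ => |t|) atTop) (𝓝 0) :=
  FloatingPlane.exists_projection_tendsto_hausdorffEDist
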